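/- **Setting.** Let $d,\nu\ge 1$, $\|x\|=\max_i|x_i|$ on $\mathbb Z^d$, and let $B_L(u)=\{x\in\mathbb Z^d:\|x-u\|\le L\}$ be the cube of radius $L$. Let $\Omega=\mathbb T^\nu=(\mathbb R/\mathbb Z)^\nu$ with the max-distance and the normalized Haar measure $\mathbb P$, let $\Theta$ be a parameter set, $(T^x)_{x\in\mathbb Z^d}$ an action of $\mathbb Z^d$ on $\Omega$ by measure-preserving maps, and $v:\Omega\times\Theta\to\mathbb R$. Assume that for some $A',C',K\in(0,\infty)$ $$\operatorname{dist}(T^x\omega,T^x\omega')\le C'\|x\|^{A'}\operatorname{dist}(\omega,\omega')\quad(\omega,\omega'\in\Omega,\ 0\ne x\in\mathbb Z^d),\qquad \|v(\cdot,\theta)\|_{C^1(\mathbb T^\nu)}\le K\quad(\theta\in\Theta),$$ the $C^1$-norm being the larger of the suprema of the function and of its first partial derivatives. For $g>0$ consider $$(H(\omega,\theta)f)(x)=\sum_{\|y-x\|_1=1}f(y)+g\,v(T^x\omega,\theta)f(x).$$ For a cube $B$ let $H_B(\omega,\theta)$ be its restriction to $B$ (Dirichlet boundary conditions), $\Sigma_{\omega,\theta}(B)$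 the spectrum of $H_B(\omega,\theta)$, and $G_B(x,y;E)$ the kernel of $(H_B(\omega,\theta)-E)^{-1}$. Given an integer $L_0$, put $L_{-1}=0$, $L_{k+1}=\lfloor L_k^{3/2}\rfloor+1$ for $k\ge0$, and $\delta_k=g^{-1/2}e^{-4L_k^{1/2}}$. **Singular cubes.** For $m>0$ put $\gamma(m,L)=m(1+L^{-1/8})$. The cube $B=B_{L_k}(u)$ is $(E,m)$-non-singular (for $\omega,\theta$) if $E\notin\Sigma_{\omega,\theta}(B)$ and $$\max_{\|x-u\|\le L_{k-1}}\ \sum_{(y,y')\in\partial B}|G_B(x,y;E)|\le e^{-\gamma(m,L_k)L_k},$$ where $\partial B$ is the set of nearest-neighbor pairs $(y,y')$ with $\|y-u\|=L_k$ and $y'\notin B$; otherwise it is $(E,m)$-singular. **The sets $\Theta_k$.** A cube $B_{L_k}(u)$ is $E$-completely non-resonant if every cube $B_\ell(w)\subset B_{L_k}(u)$ with $\ell\ge L_{k-1}$ satisfies $\operatorname{dist}(\Sigma_{\omega,\theta}(B_\ell(w)),E)\ge g\delta_k$; otherwise it is $E$-partially resonant. The cube $B_{L_k}(u)$ is tunneling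 if for some $E\in\mathbb R$ it contains two disjoint $E$-partially resonant cubes with radii of the form $L_j$, both at least $L_k^{1/4}$. Let $\mathcal T_k$ be the set of $\theta$ with $\mathbb P\{\omega: B_{L_k}(0)\text{ is tunneling}\}\ge\delta_k^{1/2}$ (the center $0$ is irrelevant, by stationarity). For $\omega'\in\Omega$ let $\mathcal R(k,\omega')$ be the set of $\theta$ for which there are pairwise disjoint cubes $B_{R_j}(w_j)\subset B_{L_k}(u_j)\subset B_{L_k^4}(0)$, $1\le j\le\nu+2$, with $R_j\in[L_{k-1},L_k]$ and $$\operatorname{dist}\big(\Sigma_{\omega',\theta}(B_{R_j}(w_j)),\Sigma_{\omega',\theta}(B_{R_1}(w_1))\big)\le4g\delta_k,\quad 2\le j\le\nu+2.$$ Let $N_k$ be the least integer with $r_k:=1/(2N_k)\le\delta_k^{1+1/(2\nu)}$, let $$\mathcal N_k=\Theta\setminus\bigcup_{l\in\{0,\dots,N_k-1\}^\nu}\mathcal R\big(k,((2l_1+1)r_k,\dots,(2l_\nu+1)r_k)\big),\qquad \Theta_k=\bigcap_{l\le k}(\mathcal N_l\setminus\mathcal T_l).$$ **Property $(\mathrm{Sparse}_k)$.**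 For every $\theta\in\Theta_k$, all $\omega\in\Omega$, all $E\in\mathbb R$ and all $u\in\mathbb Z^d$, the cube $B_{L_k^4}(u)$ contains at most $\nu+1$ pairwise disjoint $(E,m)$-singular cubes of radius $L_k$. **Theorem.** For all $d,\nu\ge1$ there are $c_1>0$ and $L_*$ such that for every integer $L_0\ge L_*$ and all $A',C',K>0$ there is $g_0>0$ (depending only on $d,\nu,L_0,A',C',K$) such that, for all $g\ge g_0$, all $0<m\le c_1\ln g$, and all $\Theta,T,v$ as above, $(\mathrm{Sparse}_k)$ holds for every $k\ge0$. Moreover, the sets $\mathcal T_l$ play no role: the same conclusion holds for every $\theta\in\bigcap_{l\le k}\mathcal N_l$. -/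

import Mathlib

noncomputable section

namespace GrandEnsemble

open MeasureTheory

/-- The lattice `ℤ^d`. Mathlib's norm on it is the max-norm `‖x‖ = max_i |x_i|`. -/
abbrev Lattice (d : ℕ) : Type := Fin d → ℤ

/-- The torus `𝕋^ν = (ℝ/ℤ)^ν`, with the max-distance of the circle distances and, as `volume`,
the normalized Haar measure (the product of the normalized Haar measures on the circles). -/
abbrev Torus (ν : ℕ) : Type := Fin ν → UnitAddCircle

/-- The `ℓ¹`-norm `‖x‖₁ = ∑ |x_i|` on the lattice. -/
def norm1 {d : ℕ} (x : Lattice d) : ℤ := ∑ i, |x i|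

/-- The lattice cube of radius `L` centered at `u`, i.e. `{x : ‖x - u‖ ≤ L}`. -/
def cube {d : ℕ} (u : Lattice d) (L : ℕ) : Finset (Lattice d) :=
  Finset.Icc (fun i => u i - (L : ℤ)) (fun i => u i + (L : ℤ))

theorem mem_cube {d : ℕ} (u x : Lattice d) (L : ℕ) : x ∈ cube u L ↔ ‖x - u‖ ≤ (L : ℝ) := by
  rw [cube, Finset.mem_Icc, pi_norm_le_iff_of_nonneg (Nat.cast_nonneg L), Pi.le_def, Pi.le_def,
    ← forall_and]
  refine forall_congr' fun i => ?_
  rw [Pi.sub_apply, Int.norm_eq_abs]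
  have h : |((x i - u i : ℤ) : ℝ)| ≤ (L : ℝ) ↔ |x i - u i| ≤ (L : ℤ) := by
    exact_mod_cast Iff.rfl
  rw [h, abs_le]
  constructor
  · rintro ⟨h1, h2⟩
    constructor <;> linarith
  · rintro ⟨h1, h2⟩
    constructor <;> linarith

/-- The boundary of a cube: the nearest-neighbor pairs `(y, y')` with `‖y - u‖ = L` and `y'`
outside the cube. -/
def boundary {d : ℕ} (u : Lattice d) (L : ℕ) : Finset (Lattice d × Lattice d) :=
  (cube u L ×ˢ cube u (L + 1)).filter fun p =>
    ‖p.1 - u‖ = (L : ℝ) ∧ p.2 ∉ cube u L ∧ norm1 (p.2 - p.1) = 1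

/-- The restriction to `Λ`, with Dirichlet boundary conditions, of the operator
`(H f)(x) = ∑_{‖y - x‖₁ = 1} f y + W x * f x`. -/
def ham {d : ℕ} (W : Lattice d → ℝ) (Λ : Finset (Lattice d)) : Matrix Λ Λ ℝ :=
  Matrix.of fun x y =>
    (if norm1 (y.1 - x.1) = 1 then 1 else 0) + (if x = y then W x.1 else 0)

/-- The spectrum of the restriction to `Λ`. -/
def spec {d : ℕ} (W : Lattice d → ℝ) (Λ : Finset (Lattice d)) : Set ℝ :=
  spectrum ℝ (ham W Λ)

open Classical in
/-- The Green function `G_Λ(x, y; E)`, the kernel of `(H_Λ - E)⁻¹`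
(meaningful when `E` is not in the spectrum and `x, y ∈ Λ`). -/
def green {d : ℕ} (W : Lattice d → ℝ) (Λ : Finset (Lattice d)) (E : ℝ) (x y : Lattice d) : ℝ :=
  if h : x ∈ Λ ∧ y ∈ Λ then
    (ham W Λ - E • (1 : Matrix Λ Λ ℝ))⁻¹ ⟨x, h.1⟩ ⟨y, h.2⟩
  else 0

/-- The distance between two sets of reals. -/
def setDist (S S' : Set ℝ) : ℝ := sInf (Set.image2 (fun a b => |a - b|) S S')

/-- The length scales: `L_{k+1} = ⌊L_k ^ (3/2)⌋ + 1`. -/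
def scale (L₀ : ℕ) : ℕ → ℕ
  | 0 => L₀
  | k + 1 => ⌊(scale L₀ k : ℝ) ^ (3 / 2 : ℝ)⌋₊ + 1

/-- `prevScale L₀ k = L_{k-1}`, with the convention `L_{-1} = 0`. -/
def prevScale (L₀ : ℕ) : ℕ → ℕ
  | 0 => 0
  | k + 1 => scale L₀ k

/-- `δ_k = g^{-1/2} exp (-4 L_k^{1/2})`. -/
def delta (g : ℝ) (L₀ k : ℕ) : ℝ :=
  g ^ (-(1 / 2) : ℝ) * Real.exp (-4 * (scale L₀ k : ℝ) ^ (1 / 2 : ℝ))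

/-- `γ(m, L) = m (1 + L^{-1/8})`. -/
def gammaRate (m : ℝ) (L : ℕ) : ℝ := m * (1 + (L : ℝ) ^ (-(1 / 8) : ℝ))

/-- The cube of radius `ℓ` centered at `w` is `E`-non-resonant at the `k`-th scale: the distance
from `E` to its spectrum is at least `g δ_k`. -/
def IsNR {d : ℕ} (W : Lattice d → ℝ) (g : ℝ) (L₀ k : ℕ) (E : ℝ) (w : Lattice d) (ℓ : ℕ) : Prop :=
  g * delta g L₀ k ≤ Metric.infDist E (spec W (cube w ℓ))

/-- The cube of radius `L_k` centered at `u` is `E`-completely non-resonant: it contains no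
resonant cube of radius `ℓ ≥ L_{k-1}`. -/
def IsCNR {d : ℕ} (W : Lattice d → ℝ) (g : ℝ) (L₀ k : ℕ) (E : ℝ) (u : Lattice d) : Prop :=
  ∀ (ℓ : ℕ) (w : Lattice d), prevScale L₀ k ≤ ℓ → cube w ℓ ⊆ cube u (scale L₀ k) →
    IsNR W g L₀ k E w ℓ

/-- `E`-partially resonant cubes of radius `L_k`. -/
def IsPR {d : ℕ} (W : Lattice d → ℝ) (g : ℝ) (L₀ k : ℕ) (E : ℝ) (u : Lattice d) : Prop :=
  ¬ IsCNR W g L₀ k E u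

/-- The cube of radius `L_k` centered at `u` is tunneling: for some energy `E` it contains two
disjoint `E`-partially resonant cubes (of radii `L_i` and `L_j`) of radius at least `L_k^{1/4}`. -/
def IsTunneling {d : ℕ} (W : Lattice d → ℝ) (g : ℝ) (L₀ k : ℕ) (u : Lattice d) : Prop :=
  ∃ (E : ℝ) (i j : ℕ) (w w' : Lattice d),
    (scale L₀ k : ℝ) ^ (1 / 4 : ℝ) ≤ (scale L₀ i : ℝ) ∧
    (scale L₀ k : ℝ) ^ (1 / 4 : ℝ) ≤ (scale L₀ j : ℝ) ∧
    cube w (scale L₀ i) ⊆ cube u (scale L₀ k) ∧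
    cube w' (scale L₀ j) ⊆ cube u (scale L₀ k) ∧
    Disjoint (cube w (scale L₀ i)) (cube w' (scale L₀ j)) ∧
    IsPR W g L₀ i E w ∧ IsPR W g L₀ j E w'

/-- The cube of radius `L_k` centered at `u` is `(E, m)`-non-singular. The resolvent at `E` has to
exist. -/
def IsNS {d : ℕ} (W : Lattice d → ℝ) (L₀ k : ℕ) (E m : ℝ) (u : Lattice d) : Prop :=
  E ∉ spec W (cube u (scale L₀ k)) ∧
  ∀ x : Lattice d, ‖x - u‖ ≤ (prevScale L₀ k : ℝ) →
    ∑ p ∈ boundary u (scale L₀ k), |green W (cube u (scale L₀ k)) E x p.1| ≤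
      Real.exp (-(gammaRate m (scale L₀ k) * (scale L₀ k : ℝ)))

/-- `(E, m)`-singular cubes of radius `L_k`. -/
def IsSingular {d : ℕ} (W : Lattice d → ℝ) (L₀ k : ℕ) (E m : ℝ) (u : Lattice d) : Prop :=
  ¬ IsNS W L₀ k E m u

section Ensemble

/-- The potential `x ↦ g V(x; ω, θ) = g v(T^x ω, θ)`. -/
def pot {d ν : ℕ} {Θ : Type*} (T : Lattice d → Torus ν → Torus ν) (v : Torus ν → Θ → ℝ) (g : ℝ)
    (ω : Torus ν) (θ : Θ) : Lattice d → ℝ :=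
  fun x => g * v (T x ω) θ

/-- `T` is an action of the group `ℤ^d` on the torus by measure-preserving maps. -/
def IsDynSystem {d ν : ℕ} (T : Lattice d → Torus ν → Torus ν) : Prop :=
  (∀ ω, T 0 ω = ω) ∧ (∀ x y ω, T (x + y) ω = T x (T y ω)) ∧
    ∀ x, MeasurePreserving (T x) volume volume

/-- The polynomial bound on the local divergence of trajectories, for all `x ≠ 0`. -/
def DIV {d ν : ℕ} (T : Lattice d → Torus ν → Torus ν) (A' C' : ℝ) : Prop :=
  ∀ (ω ω' : Torus ν) (x : Lattice d), x ≠ 0 →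
    dist (T x ω) (T x ω') ≤ C' * ‖x‖ ^ A' * dist ω ω'

/-- `f` is a `C¹` function on the torus with `‖f‖_{C¹} ≤ K`: its periodic lift to `ℝ^ν` is `C¹`,
and `f` and its first partial derivatives are bounded by `K` in absolute value. -/
def C1Bound {ν : ℕ} (f : Torus ν → ℝ) (K : ℝ) : Prop :=
  ContDiff ℝ 1 (fun t : Fin ν → ℝ => f (fun i => (t i : UnitAddCircle))) ∧
  (∀ ω, |f ω| ≤ K) ∧
  ∀ (t : Fin ν → ℝ) (i : Fin ν),
    |fderiv ℝ (fun t : Fin ν → ℝ => f (fun i => (t i : UnitAddCircle))) t (Pi.single i 1)| ≤ K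

/-- The event `R(k, ω') ⊆ Θ`: there are `J = ν + 2` pairwise disjoint cubes of radii
`R_j ∈ [L_{k-1}, L_k]`, the `j`-th one inside some cube of radius `L_k` inside the cube of radius
`L_k^4` centered at `0`, whose spectra are within `4 g δ_k` from the spectrum of the first one. -/
def resEvent {d ν : ℕ} {Θ : Type*} (T : Lattice d → Torus ν → Torus ν) (v : Torus ν → Θ → ℝ)
    (g : ℝ) (L₀ k : ℕ) (ω' : Torus ν) : Set Θ :=
  {θ | ∃ (R : Fin (ν + 2) → ℕ) (w u : Fin (ν + 2) → Lattice d),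
    (∀ j, prevScale L₀ k ≤ R j ∧ R j ≤ scale L₀ k) ∧
    (∀ j, cube (w j) (R j) ⊆ cube (u j) (scale L₀ k)) ∧
    (∀ j, cube (u j) (scale L₀ k) ⊆ cube 0 (scale L₀ k ^ 4)) ∧
    (∀ i j, i ≠ j → Disjoint (cube (w i) (R i)) (cube (w j) (R j))) ∧
    ∀ j, j ≠ 0 →
      setDist (spec (pot T v g ω' θ) (cube (w j) (R j)))
        (spec (pot T v g ω' θ) (cube (w 0) (R 0))) ≤ 4 * (g * delta g L₀ k)}

/-- The number `N_k` of subdivisions of the circle, the least integer `N` for which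
`1 / (2 N) ≤ δ_k^{1 + 1/(2ν)}`. -/
def gridNum (ν : ℕ) (g : ℝ) (L₀ k : ℕ) : ℕ :=
  ⌈1 / (2 * delta g L₀ k ^ (1 + 1 / (2 * (ν : ℝ))))⌉₊

/-- The centers `ω_i = ((2 l_1 + 1) r_k, …, (2 l_ν + 1) r_k)`, `0 ≤ l_j < N_k`, of the grid cubes
of radius `r_k = 1 / (2 N_k)` that cover the torus. -/
def gridCenter {ν : ℕ} (N : ℕ) (l : Fin ν → Fin N) : Torus ν :=
  fun i => ((((2 * (l i : ℕ) + 1 : ℕ) : ℝ) * (1 / (2 * (N : ℝ))) : ℝ) : UnitAddCircle)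

/-- The set `N_k ⊆ Θ`, the complement of the union of the events `R(k, ω_i)` over the grid. -/
def nonResSet {d ν : ℕ} {Θ : Type*} (T : Lattice d → Torus ν → Torus ν) (v : Torus ν → Θ → ℝ)
    (g : ℝ) (L₀ k : ℕ) : Set Θ :=
  (⋃ l : Fin ν → Fin (gridNum ν g L₀ k), resEvent T v g L₀ k (gridCenter _ l))ᶜ

/-- The set `T_k ⊆ Θ` of those `θ` for which a cube of radius `L_k` is tunneling with probability
at least `δ_k^{1/2}`. As `T` preserves the measure, the center of the cube is irrelevant. -/
def tunnelSet {d ν : ℕ} {Θ : Type*} (T : Lattice d → Torus ν → Torus ν) (v : Torus ν → Θ → ℝ)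
    (g : ℝ) (L₀ k : ℕ) : Set Θ :=
  {θ | ENNReal.ofReal (delta g L₀ k ^ (1 / 2 : ℝ)) ≤
    volume {ω : Torus ν | IsTunneling (pot T v g ω θ) g L₀ k 0}}

/-- The set `Θ_k = ⋂_{l ≤ k} (N_l \ T_l)`. -/
def goodSet {d ν : ℕ} {Θ : Type*} (T : Lattice d → Torus ν → Torus ν) (v : Torus ν → Θ → ℝ)
    (g : ℝ) (L₀ k : ℕ) : Set Θ :=
  ⋂ l ∈ Set.Iic k, nonResSet T v g L₀ l \ tunnelSet T v g L₀ l

/-- For all `θ ∈ S`, all `ω`, all `E`, any cube of radius `L_k^4` contains at most `ν + 1` pairwise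
disjoint `(E, m)`-singular cubes of radius `L_k`. The finite set `F` is the set of centers. -/
def SparseOn {d ν : ℕ} {Θ : Type*} (T : Lattice d → Torus ν → Torus ν) (v : Torus ν → Θ → ℝ)
    (g m : ℝ) (L₀ k : ℕ) (S : Set Θ) : Prop :=
  ∀ θ ∈ S, ∀ (ω : Torus ν) (E : ℝ) (u : Lattice d) (F : Finset (Lattice d)),
    (∀ w ∈ F, cube w (scale L₀ k) ⊆ cube u (scale L₀ k ^ 4)) →
    (∀ w ∈ F, ∀ w' ∈ F, w ≠ w' → Disjoint (cube w (scale L₀ k)) (cube w' (scale L₀ k))) →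
    (∀ w ∈ F, IsSingular (pot T v g ω θ) L₀ k E m w) →
    F.card ≤ ν + 1

/-- The property `(Sparse_k)`. -/
def Sparse {d ν : ℕ} {Θ : Type*} (T : Lattice d → Torus ν → Torus ν) (v : Torus ν → Θ → ℝ)
    (g m : ℝ) (L₀ k : ℕ) : Prop :=
  SparseOn T v g m L₀ k (goodSet T v g L₀ k)

end Ensemble

end GrandEnsemble

end

/-! Two facts, combined by induction on `k`, carry the proof.

Resonances are rare (`card_le_of_isPR`). Suppose that for some `ω` and `E` a cube of radius `L_k ^
4` centered at `u` contained `ν + 2` disjoint partially resonant cubes. Each contains a subcube with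
an eigenvalue within `g δ_k` of `E`. Translate the center to `0`, which turns `ω` into `T^u ω`, and
replace `T^u ω` by the nearest grid point. The `C¹` bound on `v` and the polynomial divergence of
trajectories move each eigenvalue by at most `g δ_k` (`exists_spec_near`). Hence the spectra lie
within `4 g δ_k` of each other at a grid point, which membership in `nonResSet` forbids.

A singular cube is partially resonant (`isNS_zero`, `isNS_succ`). In a completely non-resonant cube
of radius `L_{k+1}`, the induction hypothesis allows at most `ν + 1` disjoint singular cubes of
radius `L_k`, so singular centers occupy only `O(L_k)` distances from the center. At every other
distance the geometric resolvent inequality gains a factor (`boundarySum_le_of_good_radius`), bad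
distances are skipped one by one (`radial_descent`), and the number of gains suffices for decay at
the next scale (`exists_jumps`).

Complete non-resonance controls the concentric cubes of all radii from `L_k` to `L_{k+1}`, so how
the singular cubes are placed is irrelevant. This is why tunneling never enters and the sets
`tunnelSet` can be dropped. -/

noncomputable section

namespace GrandEnsemble

open MeasureTheory

/-! ### Cubes and the max-distance in natural numbers. -/

section Geometry

variable {d : ℕ}

/-- The max-distance of two lattice points, as a natural number. -/
def rad (u x : Lattice d) : ℕ := Finset.univ.sup fun i => (x i - u i).natAbs

theorem rad_le_iff {u x : Lattice d} {L : ℕ} : rad u x ≤ L ↔ ∀ i, (x i - u i).natAbs ≤ L := by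
  simp [rad, Finset.sup_le_iff]

theorem mem_cube_iff_rad {u x : Lattice d} {L : ℕ} : x ∈ cube u L ↔ rad u x ≤ L := by
  rw [rad_le_iff, cube, Finset.mem_Icc, Pi.le_def, Pi.le_def, ← forall_and]
  refine forall_congr' fun i => ?_
  constructor
  · rintro ⟨h1, h2⟩
    omega
  · intro h
    constructor <;> omega

theorem norm_sub_eq_rad (u x : Lattice d) : ‖x - u‖ = (rad u x : ℝ) := by
  refine le_antisymm ((mem_cube u x _).1 (mem_cube_iff_rad.2 le_rfl)) ?_
  have h : rad u x ≤ ⌊‖x - u‖⌋₊ := by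
    rw [rad_le_iff]
    intro i
    refine Nat.le_floor ?_
    have h1 := norm_le_pi_norm (x - u) i
    rw [Pi.sub_apply, Int.norm_eq_abs] at h1
    rwa [Nat.cast_natAbs, Int.cast_abs]
  exact (Nat.cast_le.2 h).trans (Nat.floor_le (norm_nonneg _))

theorem rad_triangle (u w x : Lattice d) : rad u x ≤ rad u w + rad w x := by
  rw [rad_le_iff]
  intro i
  have h1 := rad_le_iff.1 (le_refl (rad u w)) i
  have h2 := rad_le_iff.1 (le_refl (rad w x)) i
  omega

theorem rad_comm (u x : Lattice d) : rad u x = rad x u := by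
  unfold rad
  exact Finset.sup_congr rfl fun i _ => by omega

theorem rad_self (u : Lattice d) : rad u u = 0 := by
  simp [rad]

theorem self_mem_cube (u : Lattice d) (L : ℕ) : u ∈ cube u L := by
  rw [mem_cube_iff_rad, rad_self]
  exact Nat.zero_le _

theorem cube_subset_cube {u w : Lattice d} {r L : ℕ} (h : rad u w + r ≤ L) :
    cube w r ⊆ cube u L := by
  intro x hx
  rw [mem_cube_iff_rad] at hx ⊢
  have := rad_triangle u w x
  omega

/-- Compare two opposite corners along one axis. For `d = 0` all cubes coincide and the claim fails.
-/
theorem le_of_cube_subset_cube (hd : 1 ≤ d) {u w : Lattice d} {r L : ℕ}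
    (h : cube w r ⊆ cube u L) : r ≤ L := by
  have h1 : (fun i => w i + (r : ℤ)) ∈ cube w r := by
    rw [mem_cube_iff_rad, rad_le_iff]
    intro i
    simp
  have h2 : (fun i => w i - (r : ℤ)) ∈ cube w r := by
    rw [mem_cube_iff_rad, rad_le_iff]
    intro i
    simp
  have h3 := rad_le_iff.1 (mem_cube_iff_rad.1 (h h1)) ⟨0, hd⟩
  have h4 := rad_le_iff.1 (mem_cube_iff_rad.1 (h h2)) ⟨0, hd⟩
  omega

theorem sub_mem_cube_sub_iff {u c x : Lattice d} {r : ℕ} :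
    x - u ∈ cube (c - u) r ↔ x ∈ cube c r := by
  simp [mem_cube_iff_rad, rad]

theorem mem_cube_sub_iff {u c x : Lattice d} {r : ℕ} :
    x ∈ cube (c - u) r ↔ x + u ∈ cube c r := by
  rw [← sub_mem_cube_sub_iff (u := u) (x := x + u), add_sub_cancel_right]

theorem norm1_comm (x y : Lattice d) : norm1 (x - y) = norm1 (y - x) := by
  simp only [norm1, Pi.sub_apply]
  exact Finset.sum_congr rfl fun i _ => abs_sub_comm _ _

theorem rad_le_one_of_norm1 {x y : Lattice d} (h : norm1 (y - x) = 1) : rad x y ≤ 1 := by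
  rw [rad_le_iff]
  intro i
  have h1 : |(y - x) i| ≤ norm1 (y - x) :=
    Finset.single_le_sum (f := fun i => |(y - x) i|) (fun i _ => abs_nonneg _) (Finset.mem_univ i)
  rw [h, Pi.sub_apply, Int.abs_eq_natAbs] at h1
  omega

theorem mem_boundary_of {u x y : Lattice d} {L : ℕ} (hx : x ∈ cube u L) (hy : y ∉ cube u L)
    (h : norm1 (y - x) = 1) : (x, y) ∈ boundary u L := by
  have h1 := rad_le_one_of_norm1 h
  have h2 := rad_triangle u x y
  rw [mem_cube_iff_rad] at hx hy
  have h3 : rad u x = L := by omega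
  simp only [boundary, Finset.mem_filter, Finset.mem_product, mem_cube_iff_rad, norm_sub_eq_rad]
  refine ⟨⟨hx, by omega⟩, by rw [h3], hy, h⟩

theorem rad_fst_of_mem_boundary {u : Lattice d} {L : ℕ} {p : Lattice d × Lattice d}
    (h : p ∈ boundary u L) : rad u p.1 = L := by
  simp only [boundary, Finset.mem_filter, norm_sub_eq_rad] at h
  exact_mod_cast h.2.1

theorem rad_snd_of_mem_boundary {u : Lattice d} {L : ℕ} {p : Lattice d × Lattice d}
    (h : p ∈ boundary u L) : rad u p.2 = L + 1 := by
  simp only [boundary, Finset.mem_filter, Finset.mem_product, mem_cube_iff_rad] at h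
  omega

theorem card_cube (u : Lattice d) (L : ℕ) : (cube u L).card = (2 * L + 1) ^ d := by
  rw [cube, Pi.card_Icc]
  have h : ∀ i : Fin d, (Finset.Icc (u i - (L : ℤ)) (u i + L)).card = 2 * L + 1 := by
    intro i
    rw [Int.card_Icc]
    omega
  simp [h]

theorem card_boundary_le (u : Lattice d) (L : ℕ) :
    (boundary u L).card ≤ (2 * L + 3) ^ (2 * d) := by
  refine (Finset.card_filter_le _ _).trans ?_
  rw [Finset.card_product, card_cube, card_cube, two_mul d, pow_add]
  exact Nat.mul_le_mul (Nat.pow_le_pow_left (by omega) _) (Nat.pow_le_pow_left (by omega) _)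

end Geometry

/-! ### Resolvent bounds and eigenvalue perturbation from approximate eigenvectors. -/

section Spectral

/-- Expand `ψ` in an orthonormal eigenbasis, apply Parseval, and take the eigenvalue nearest to `E`.
This yields both `abs_green_le` and `exists_spec_near`. -/
theorem exists_mem_spectrum_sq_le {n : Type*} [Fintype n] [DecidableEq n] [Nonempty n]
    {A : Matrix n n ℝ} (hA : A.IsHermitian) (E : ℝ) (ψ : n → ℝ) :
    ∃ μ ∈ spectrum ℝ A, (μ - E) ^ 2 * ∑ i, ψ i ^ 2 ≤ ∑ i, ((A.mulVec ψ) i - E * ψ i) ^ 2 := by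
  obtain ⟨k, hk⟩ := Finite.exists_min fun i => (hA.eigenvalues i - E) ^ 2
  refine ⟨hA.eigenvalues k, ?_, ?_⟩
  · rw [hA.spectrum_real_eq_range_eigenvalues]
    exact ⟨k, rfl⟩
  set b := hA.eigenvectorBasis with hb
  have parseval : ∀ φ : n → ℝ, ∑ i, (inner ℝ (b i) (WithLp.toLp 2 φ)) ^ 2 = ∑ i, φ i ^ 2 := by
    intro φ
    have h := b.sum_sq_norm_inner_right (WithLp.toLp 2 φ)
    rw [EuclideanSpace.norm_sq_eq] at h
    simpa using h
  have key : ∀ i, inner ℝ (b i) (WithLp.toLp 2 fun j => (A.mulVec ψ) j - E * ψ j) =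
      (hA.eigenvalues i - E) * inner ℝ (b i) (WithLp.toLp 2 ψ) := by
    intro i
    have h1 := hA.mulVec_eigenvectorBasis i
    have h2 : Matrix.transpose A = A := by
      have := hA.eq
      rwa [Matrix.conjTranspose_eq_transpose_of_trivial] at this
    have h3 : dotProduct (A.mulVec ψ) (⇑(b i)) = hA.eigenvalues i * dotProduct ψ (⇑(b i)) := by
      rw [dotProduct_comm, Matrix.dotProduct_mulVec, ← Matrix.mulVec_transpose, h2, hb, h1,
        smul_dotProduct, smul_eq_mul, dotProduct_comm]
    simp only [EuclideanSpace.inner_eq_star_dotProduct, star_trivial]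
    have h4 : (fun j => (A.mulVec ψ) j - E * ψ j) = A.mulVec ψ - E • ψ := by
      funext j
      simp
    rw [h4, sub_dotProduct, h3, smul_dotProduct, smul_eq_mul]
    ring
  rw [← parseval ψ, ← parseval fun j => (A.mulVec ψ) j - E * ψ j, Finset.mul_sum]
  refine Finset.sum_le_sum fun i _ => ?_
  rw [key i, mul_pow]
  exact mul_le_mul_of_nonneg_right (hk i) (sq_nonneg _)

variable {d : ℕ}

instance (u : Lattice d) (L : ℕ) : Nonempty (cube u L) := ⟨⟨u, self_mem_cube u L⟩⟩

theorem ham_isHermitian (W : Lattice d → ℝ) (Λ : Finset (Lattice d)) :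
    (ham W Λ).IsHermitian := by
  ext x y
  simp only [ham, Matrix.conjTranspose_apply, Matrix.of_apply, star_trivial]
  rw [norm1_comm x.1 y.1]
  by_cases h : x = y
  · subst h; rfl
  · rw [if_neg h, if_neg (Ne.symm h)]

theorem ham_sub_smul_one_apply (W : Lattice d → ℝ) (Λ : Finset (Lattice d)) (E : ℝ) (x y : Λ) :
    (ham W Λ - E • (1 : Matrix Λ Λ ℝ)) x y =
      (if norm1 (y.1 - x.1) = 1 then 1 else 0) + (if x = y then W x.1 - E else 0) := by
  simp only [ham, Matrix.sub_apply, Matrix.of_apply, Matrix.smul_apply, Matrix.one_apply,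
    smul_eq_mul]
  by_cases h : x = y
  · simp only [if_pos h]
    ring
  · simp [h]

theorem spec_nonempty (W : Lattice d → ℝ) (u : Lattice d) (L : ℕ) :
    (spec W (cube u L)).Nonempty := by
  obtain ⟨μ, hμ, -⟩ := exists_mem_spectrum_sq_le (ham_isHermitian W (cube u L)) 0 0
  exact ⟨μ, hμ⟩

theorem notMem_of_le_infDist {S : Set ℝ} {E η : ℝ} (hη : 0 < η) (h : η ≤ Metric.infDist E S) :
    E ∉ S := by
  intro hE
  rw [Metric.infDist_zero_of_mem hE] at h
  exact absurd h (not_le.2 hη)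

theorem isUnit_det_of_notMem_spec {W : Lattice d → ℝ} {Λ : Finset (Lattice d)} {E : ℝ}
    (h : E ∉ spec W Λ) : IsUnit (ham W Λ - E • (1 : Matrix Λ Λ ℝ)).det := by
  rw [spec, spectrum.notMem_iff, Algebra.algebraMap_eq_smul_one, ← IsUnit.neg_iff, neg_sub] at h
  rwa [← Matrix.isUnit_iff_isUnit_det]

theorem abs_green_le {W : Lattice d → ℝ} {u : Lattice d} {L : ℕ} {E η : ℝ} (hη : 0 < η)
    (h : η ≤ Metric.infDist E (spec W (cube u L))) (x y : Lattice d) :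
    |green W (cube u L) E x y| ≤ 1 / η := by
  classical
  rw [green]
  split_ifs with hxy
  · set A := ham W (cube u L) with hA
    have hdet := isUnit_det_of_notMem_spec (notMem_of_le_infDist hη h)
    rw [← hA] at hdet
    set X : cube u L := ⟨x, hxy.1⟩
    set Y : cube u L := ⟨y, hxy.2⟩
    -- A column of the resolvent: `(A - E) ψ` is a unit coordinate vector, so the residual has norm
    -- 1.
    set ψ : cube u L → ℝ := fun z => (A - E • (1 : Matrix (cube u L) (cube u L) ℝ))⁻¹ z Y with hψ
    obtain ⟨μ, hμ, hle⟩ := exists_mem_spectrum_sq_le (ham_isHermitian W (cube u L)) E ψ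
    rw [← hA] at hle
    have h1 : ∀ i, (A.mulVec ψ) i - E * ψ i = (1 : Matrix (cube u L) (cube u L) ℝ) i Y := by
      intro i
      rw [← Matrix.mul_nonsing_inv _ hdet, Matrix.sub_mul, Matrix.sub_apply, Matrix.smul_mul,
        Matrix.one_mul, Matrix.smul_apply, smul_eq_mul]
      rfl
    have h2 : ∑ i, ((A.mulVec ψ) i - E * ψ i) ^ 2 = 1 := by
      simp [h1, Matrix.one_apply]
    rw [h2] at hle
    have h3 : η ≤ |μ - E| := by
      refine h.trans ?_
      have := Metric.infDist_le_dist_of_mem (x := E) hμ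
      rwa [Real.dist_eq, abs_sub_comm] at this
    have h4 : ψ X ^ 2 ≤ ∑ i, ψ i ^ 2 :=
      Finset.single_le_sum (f := fun i => ψ i ^ 2) (fun i _ => sq_nonneg _) (Finset.mem_univ X)
    have h5 : (η * |ψ X|) ^ 2 ≤ 1 := by
      calc (η * |ψ X|) ^ 2 = η ^ 2 * ψ X ^ 2 := by rw [mul_pow, sq_abs]
        _ ≤ (μ - E) ^ 2 * ∑ i, ψ i ^ 2 := by
          refine mul_le_mul ?_ h4 (sq_nonneg _) (sq_nonneg _)
          rw [← sq_abs (μ - E)]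
          exact pow_le_pow_left₀ hη.le h3 2
        _ ≤ 1 := hle
    have h6 : η * |ψ X| ≤ 1 := by
      rw [sq_le_one_iff₀ (by positivity)] at h5
      exact h5
    rw [le_div_iff₀ hη, mul_comm]
    exact h6
  · rw [abs_zero]
    positivity

/-- Translating a cube and perturbing the potential by at most `ε` moves each eigenvalue by at
most `ε`. -/
theorem exists_spec_near {W W' : Lattice d → ℝ} {u c : Lattice d} {r : ℕ} {ε : ℝ}
    (h : ∀ x ∈ cube c r, |W x - W' (x - u)| ≤ ε) {a : ℝ} (ha : a ∈ spec W (cube c r)) :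
    ∃ a' ∈ spec W' (cube (c - u) r), |a' - a| ≤ ε := by
  classical
  have hε : 0 ≤ ε := (abs_nonneg _).trans (h c (self_mem_cube c r))
  have hH := ham_isHermitian W (cube c r)
  rw [spec, hH.spectrum_real_eq_range_eigenvalues] at ha
  obtain ⟨k, rfl⟩ := ha
  set ψ : cube c r → ℝ := ⇑(hH.eigenvectorBasis k) with hψ
  have hψ1 : ∑ i, ψ i ^ 2 = 1 := by
    have h1 := hH.eigenvectorBasis.orthonormal.1 k
    have h2 := EuclideanSpace.norm_sq_eq (hH.eigenvectorBasis k)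
    rw [h1] at h2
    simpa using h2.symm
  let e : cube (c - u) r ≃ cube c r :=
    { toFun := fun x => ⟨x.1 + u, mem_cube_sub_iff.1 x.2⟩
      invFun := fun x => ⟨x.1 - u, sub_mem_cube_sub_iff.2 x.2⟩
      left_inv := fun x => by simp
      right_inv := fun x => by simp }
  have hmat : ham W' (cube (c - u) r) = (ham W (cube c r)).submatrix e e +
      Matrix.diagonal fun x => W' x.1 - W (x.1 + u) := by
    ext x y
    simp only [ham, Matrix.add_apply, Matrix.submatrix_apply, Matrix.of_apply,
      Matrix.diagonal_apply, e.apply_eq_iff_eq]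
    have h1 : (e y).1 - (e x).1 = y.1 - x.1 := add_sub_add_right_eq_sub _ _ _
    have h2 : (e x).1 = x.1 + u := rfl
    rw [h1, h2]
    by_cases hxy : x = y <;> simp [hxy]
  -- The translated eigenvector is an approximate eigenvector of the perturbed matrix; its residual
  -- is the difference of potentials times `ψ`.
  obtain ⟨μ, hμ, hle⟩ := exists_mem_spectrum_sq_le (ham_isHermitian W' (cube (c - u) r))
    (hH.eigenvalues k) (ψ ∘ e)
  refine ⟨μ, hμ, ?_⟩
  have h1 : ∑ i, (ψ ∘ e) i ^ 2 = 1 := by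
    rw [← hψ1]
    exact e.sum_comp fun i => ψ i ^ 2
  have h2 : ∀ i, ((ham W' (cube (c - u) r)).mulVec (ψ ∘ e)) i - hH.eigenvalues k * (ψ ∘ e) i =
      (W' i.1 - W (i.1 + u)) * (ψ ∘ e) i := by
    intro i
    have h3 : (ham W (cube c r)).mulVec ψ = hH.eigenvalues k • ψ := hH.mulVec_eigenvectorBasis k
    rw [hmat, Matrix.add_mulVec, Matrix.submatrix_mulVec_equiv, Pi.add_apply,
      Matrix.mulVec_diagonal]
    simp only [Function.comp_def, Equiv.apply_symm_apply]
    rw [h3]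
    simp
  rw [h1, mul_one] at hle
  have h4 : (μ - hH.eigenvalues k) ^ 2 ≤ ε ^ 2 := by
    refine hle.trans ?_
    rw [← mul_one (ε ^ 2), ← h1, Finset.mul_sum]
    refine Finset.sum_le_sum fun i _ => ?_
    rw [h2 i, mul_pow]
    refine mul_le_mul_of_nonneg_right ?_ (sq_nonneg _)
    have h5 := h _ (mem_cube_sub_iff.1 i.2)
    rw [add_sub_cancel_right, abs_sub_comm] at h5
    rw [← sq_abs]
    exact pow_le_pow_left₀ (abs_nonneg _) h5 2
  exact abs_le_of_sq_le_sq h4 hε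

end Spectral

/-! ### The geometric resolvent identity and inequality. -/

section Resolvent

variable {d : ℕ}

/-- The geometric resolvent identity. -/
theorem green_eq_neg_sum {W : Lattice d → ℝ} {Λ : Finset (Lattice d)} {w : Lattice d} {r : ℕ}
    {E : ℝ} (hsub : cube w r ⊆ Λ) (hΛ : E ∉ spec W Λ) (hB : E ∉ spec W (cube w r))
    {x y : Lattice d} (hx : x ∈ cube w r) (hy : y ∈ Λ) (hyB : y ∉ cube w r) :
    green W Λ E x y = -∑ p ∈ boundary w r, green W (cube w r) E x p.1 * green W Λ E p.2 y := by
  classical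
  set B := cube w r with hBdef
  set φ : Lattice d → ℝ := fun z => green W Λ E z y with hφ
  have hφΛ : ∀ z (hz : z ∈ Λ), φ z = (ham W Λ - E • (1 : Matrix Λ Λ ℝ))⁻¹ ⟨z, hz⟩ ⟨y, hy⟩ := by
    intro z hz
    simp only [hφ, green]
    rw [dif_pos ⟨hz, hy⟩]
  have hφ0 : ∀ z, z ∉ Λ → φ z = 0 := by
    intro z hz
    simp only [hφ, green]
    rw [dif_neg fun h => hz h.1]
  have hdetΛ := isUnit_det_of_notMem_spec hΛ
  have hdetB := isUnit_det_of_notMem_spec hB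
  let hop : Lattice d → Lattice d → ℝ := fun z z' => if norm1 (z' - z) = 1 then 1 else 0
  -- As `y ∉ B`, the column `φ` solves the homogeneous equation throughout `B`. Moving the hops that
  -- leave `B` to the right and inverting `H_B - E` gives the identity.
  have eqΛ : ∀ z ∈ B, ∑ z' ∈ Λ, hop z z' * φ z' + (W z - E) * φ z = 0 := by
    intro z hz
    have hzΛ := hsub hz
    have h1 := congrFun (congrFun (Matrix.mul_nonsing_inv _ hdetΛ) ⟨z, hzΛ⟩) ⟨y, hy⟩
    rw [Matrix.one_apply, if_neg (fun h => hyB (by rw [← Subtype.mk.inj h]; exact hz)),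
      Matrix.mul_apply] at h1
    rw [← h1, ← Finset.sum_coe_sort Λ]
    have h2 : (W z - E) * φ z = ∑ z' : Λ, (if (⟨z, hzΛ⟩ : Λ) = z' then W z - E else 0) * φ z' := by
      simp
    rw [h2, ← Finset.sum_add_distrib]
    refine Finset.sum_congr rfl fun z' _ => ?_
    rw [hφΛ z' z'.2, ham_sub_smul_one_apply]
    exact (add_mul _ _ _).symm
  have eqB : ∀ z (hz : z ∈ B), ∑ z' : B, (ham W B - E • (1 : Matrix B B ℝ)) ⟨z, hz⟩ z' * φ z' =
      -∑ z' ∈ Λ \ B, hop z z' * φ z' := by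
    intro z hz
    have h1 := eqΛ z hz
    rw [← Finset.sum_sdiff hsub, ← Finset.sum_coe_sort B] at h1
    have h2 : (W z - E) * φ z = ∑ z' : B, (if (⟨z, hz⟩ : B) = z' then W z - E else 0) * φ z' := by
      simp
    rw [h2, add_assoc, ← Finset.sum_add_distrib] at h1
    rw [← eq_neg_iff_add_eq_zero.2 ((add_comm _ _).trans h1)]
    refine Finset.sum_congr rfl fun z' _ => ?_
    rw [ham_sub_smul_one_apply]
    exact add_mul _ _ _
  have hsolve : φ x = -∑ z : B, green W B E x z * ∑ z' ∈ Λ \ B, hop z z' * φ z' := by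
    have h1 : (ham W B - E • (1 : Matrix B B ℝ)).mulVec (fun z => φ z) =
        fun z : B => -∑ z' ∈ Λ \ B, hop z z' * φ z' := by
      funext z
      exact eqB z z.2
    have h2 := congrArg (ham W B - E • (1 : Matrix B B ℝ))⁻¹.mulVec h1
    rw [Matrix.mulVec_mulVec, Matrix.nonsing_inv_mul _ hdetB, Matrix.one_mulVec] at h2
    have h3 := congrFun h2 ⟨x, hx⟩
    simp only at h3
    rw [h3, ← Finset.sum_neg_distrib]
    refine Finset.sum_congr rfl fun z _ => ?_
    rw [green, dif_pos ⟨hx, z.2⟩, mul_neg]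
  change φ x = _
  rw [hsolve, neg_inj, Finset.sum_coe_sort B fun z => green W B E x z * ∑ z' ∈ Λ \ B, hop z z' * φ z']
  simp_rw [Finset.mul_sum]
  rw [← Finset.sum_product']
  -- The boundary of `B` may leave `Λ`; there `green` has the default value 0, so the sum may run
  -- over all of it.
  have h0 : ∑ p ∈ (boundary w r).filter (fun p => p.2 ∈ Λ), green W B E x p.1 * φ p.2 =
      ∑ p ∈ B ×ˢ (Λ \ B), green W B E x p.1 * (hop p.1 p.2 * φ p.2) := by
    refine Finset.sum_subset_zero_on_sdiff ?_ ?_ ?_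
    · intro p hp
      rw [Finset.mem_filter] at hp
      have h1 := rad_fst_of_mem_boundary hp.1
      have h2 := rad_snd_of_mem_boundary hp.1
      rw [Finset.mem_product, Finset.mem_sdiff, hBdef, mem_cube_iff_rad, mem_cube_iff_rad]
      exact ⟨h1.le, hp.2, by omega⟩
    · rintro p hp
      rw [Finset.mem_sdiff, Finset.mem_product, Finset.mem_sdiff, Finset.mem_filter] at hp
      have h1 : ¬ norm1 (p.2 - p.1) = 1 := fun h1 =>
        hp.2 ⟨mem_boundary_of hp.1.1 hp.1.2.2 h1, hp.1.2.1⟩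
      simp [hop, h1]
    · intro p hp
      rw [Finset.mem_filter] at hp
      have h1 : norm1 (p.2 - p.1) = 1 := by
        have := hp.1
        simp only [boundary, Finset.mem_filter] at this
        exact this.2.2.2
      simp [hop, h1]
  rw [← h0, Finset.sum_filter]
  refine Finset.sum_congr rfl fun p _ => ?_
  split_ifs with h
  · rfl
  · change 0 = _ * φ p.2
    rw [hφ0 _ h, mul_zero]

/-- The sum `∑_{(y, y') ∈ ∂B} |G_B(x, y; E)|` over the boundary of the cube `B`. -/
def boundarySum (W : Lattice d → ℝ) (u : Lattice d) (N : ℕ) (E : ℝ) (x : Lattice d) : ℝ :=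
  ∑ p ∈ boundary u N, |green W (cube u N) E x p.1|

theorem boundarySum_le_card_div {W : Lattice d → ℝ} {u : Lattice d} {N : ℕ} {E η : ℝ}
    (hη : 0 < η) (h : η ≤ Metric.infDist E (spec W (cube u N))) (x : Lattice d) :
    boundarySum W u N E x ≤ (2 * N + 3 : ℝ) ^ (2 * d) / η := by
  calc boundarySum W u N E x ≤ ∑ p ∈ boundary u N, 1 / η :=
        Finset.sum_le_sum fun p _ => abs_green_le hη h x p.1
    _ = (boundary u N).card * (1 / η) := by rw [Finset.sum_const, nsmul_eq_mul]
    _ ≤ (2 * N + 3 : ℝ) ^ (2 * d) * (1 / η) := by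
        refine mul_le_mul_of_nonneg_right ?_ (by positivity)
        exact_mod_cast card_boundary_le u N
    _ = _ := by ring

/-- The geometric resolvent inequality. -/
theorem boundarySum_le_sum {W : Lattice d → ℝ} {u w : Lattice d} {N r : ℕ} {E : ℝ}
    (hsub : rad u w + r < N) (hΛ : E ∉ spec W (cube u N)) (hB : E ∉ spec W (cube w r))
    {x : Lattice d} (hx : x ∈ cube w r) :
    boundarySum W u N E x ≤
      ∑ b ∈ boundary w r, |green W (cube w r) E x b.1| * boundarySum W u N E b.2 := by
  have h1 : ∀ p ∈ boundary u N, |green W (cube u N) E x p.1| ≤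
      ∑ b ∈ boundary w r, |green W (cube w r) E x b.1| * |green W (cube u N) E b.2 p.1| := by
    intro p hp
    have hp1 := rad_fst_of_mem_boundary hp
    -- The strict inequality `rad u w + r < N` is needed here: the smaller cube must not touch the
    -- inner boundary of the larger one.
    have hpB : p.1 ∉ cube w r := by
      rw [mem_cube_iff_rad]
      have := rad_triangle u w p.1
      omega
    rw [green_eq_neg_sum (cube_subset_cube hsub.le) hΛ hB hx (mem_cube_iff_rad.2 hp1.le) hpB,
      abs_neg]
    refine (Finset.abs_sum_le_sum_abs _ _).trans (le_of_eq ?_)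
    exact Finset.sum_congr rfl fun b _ => abs_mul _ _
  refine (Finset.sum_le_sum h1).trans (le_of_eq ?_)
  rw [Finset.sum_comm]
  refine Finset.sum_congr rfl fun b _ => ?_
  rw [boundarySum, Finset.mul_sum]

theorem boundarySum_le_mul {W : Lattice d → ℝ} {u w : Lattice d} {N r : ℕ} {E M : ℝ}
    (hsub : rad u w + r < N) (hΛ : E ∉ spec W (cube u N)) (hB : E ∉ spec W (cube w r))
    {x : Lattice d} (hx : x ∈ cube w r)
    (hM : ∀ z, rad w z = r + 1 → boundarySum W u N E z ≤ M) :
    boundarySum W u N E x ≤ boundarySum W w r E x * M := by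
  refine (boundarySum_le_sum hsub hΛ hB hx).trans ?_
  rw [boundarySum.eq_def W w, Finset.sum_mul]
  exact Finset.sum_le_sum fun b hb =>
    mul_le_mul_of_nonneg_left (hM _ (rad_snd_of_mem_boundary hb)) (abs_nonneg _)

end Resolvent

/-! ### Iterating the resolvent inequality along radii. -/

section Descent

variable {d : ℕ}

/-- If `S` contains at most `c` points whose cubes of radius `n` are pairwise disjoint, then the
points of `S` have at most `c * (4 * n + 1)` different distances from `u`. -/
theorem card_image_rad_le {u : Lattice d} {n c : ℕ} (S : Finset (Lattice d))
    (hS : ∀ F ⊆ S, (∀ w ∈ F, ∀ w' ∈ F, w ≠ w' → Disjoint (cube w n) (cube w' n)) → F.card ≤ c) :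
    (S.image (rad u)).card ≤ c * (4 * n + 1) := by
  classical
  set P := S.powerset.filter fun F =>
    ∀ w ∈ F, ∀ w' ∈ F, w ≠ w' → Disjoint (cube w n) (cube w' n) with hP
  have hne : P.Nonempty := ⟨∅, by simp [hP]⟩
  -- By maximality the cube of each point of `S` meets the cube of some `w ∈ F`, so its distance
  -- from `u` differs from that of `w` by at most `2 * n`.
  obtain ⟨F, hF, hmax⟩ := P.exists_max_image Finset.card hne
  have hF' := hF
  rw [hP, Finset.mem_filter, Finset.mem_powerset] at hF'
  have hcover : ∀ z ∈ S, ∃ w ∈ F, ¬ Disjoint (cube z n) (cube w n) := by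
    intro z hz
    by_contra! hcon
    have hzF : z ∉ F := fun h =>
      Finset.disjoint_left.1 (hcon z h) (self_mem_cube z n) (self_mem_cube z n)
    have h1 : insert z F ∈ P := by
      rw [hP, Finset.mem_filter, Finset.mem_powerset]
      refine ⟨Finset.insert_subset hz hF'.1, ?_⟩
      intro w hw w' hw' hne
      rcases Finset.mem_insert.1 hw with h | h <;> rcases Finset.mem_insert.1 hw' with h' | h'
      · exact absurd (h.trans h'.symm) hne
      · exact h ▸ hcon w' h'
      · exact h' ▸ (hcon w h).symm
      · exact hF'.2 w h w' h' hne
    have h2 := hmax _ h1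
    rw [Finset.card_insert_of_notMem hzF] at h2
    omega
  have hsub : S.image (rad u) ⊆
      F.biUnion fun w => Finset.Icc (rad u w - 2 * n) (rad u w + 2 * n) := by
    intro r hr
    obtain ⟨z, hz, rfl⟩ := Finset.mem_image.1 hr
    obtain ⟨w, hw, hzw⟩ := hcover z hz
    obtain ⟨y, hy1, hy2⟩ := Finset.not_disjoint_iff.1 hzw
    rw [mem_cube_iff_rad] at hy1 hy2
    have h1 := rad_triangle z y w
    have h2 := rad_triangle u w z
    have h3 := rad_triangle u z w
    rw [rad_comm y w] at h1
    rw [rad_comm w z] at h2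
    rw [Finset.mem_biUnion]
    exact ⟨w, hw, Finset.mem_Icc.2 ⟨by omega, by omega⟩⟩
  calc (S.image (rad u)).card ≤ _ := Finset.card_le_card hsub
    _ ≤ F.card * (4 * n + 1) := Finset.card_biUnion_le_card_mul _ _ _ fun w _ => by
        rw [Nat.card_Icc]
        omega
    _ ≤ c * (4 * n + 1) := Nat.mul_le_mul_right _ (hS F hF'.1 hF'.2)

/-- If, at all radii outside a finite set, passing from the cube of radius `r` to that of radius
`r + n + 1` gains a factor `q`, then one gains `q ^ j` between the radii `r` and `N` as soon as
there is room for `j` jumps and all bad radii. -/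
theorem radial_descent {f : Lattice d → ℝ} {u : Lattice d} {n N a : ℕ} {q M : ℝ} (hq : 0 ≤ q)
    (hM0 : 0 ≤ M) (bad : Finset ℕ) (hM : ∀ x ∈ cube u N, f x ≤ M)
    (step : ∀ r M', a ≤ r → r + n + 1 ≤ N → r ∉ bad → 0 ≤ M' →
      (∀ x ∈ cube u (r + n + 1), f x ≤ M') → ∀ x ∈ cube u r, f x ≤ q * M')
    (s j r : ℕ) (hs : r + s = N) (har : a ≤ r)
    (hj : (n + 1) * j + (bad.filter (r ≤ ·)).card ≤ s) :
    ∀ x ∈ cube u r, f x ≤ q ^ j * M := by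
  induction s using Nat.strong_induction_on generalizing j r with
  | _ s ih =>
    intro x hx
    rcases j with _ | j
    · rw [pow_zero, one_mul]
      refine hM x ?_
      rw [mem_cube_iff_rad] at hx ⊢
      omega
    · rw [Nat.mul_succ] at hj
      -- A bad radius costs one unit of room, paid by its own removal from the count of bad radii; a
      -- good one costs `n + 1` and uses up one jump.
      by_cases hr : r ∈ bad
      · have h1 : (bad.filter (r + 1 ≤ ·)).card < (bad.filter (r ≤ ·)).card := by
          refine Finset.card_lt_card ((Finset.ssubset_iff_of_subset ?_).2 ⟨r, ?_, ?_⟩)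
          · intro t ht
            rw [Finset.mem_filter] at ht ⊢
            exact ⟨ht.1, by omega⟩
          · exact Finset.mem_filter.2 ⟨hr, le_rfl⟩
          · rw [Finset.mem_filter]
            omega
        refine ih (s - 1) (by omega) (j + 1) (r + 1) (by omega) (by omega) ?_ x ?_
        · rw [Nat.mul_succ]
          omega
        · rw [mem_cube_iff_rad] at hx ⊢
          omega
      · have h1 : (bad.filter (r + n + 1 ≤ ·)).card ≤ (bad.filter (r ≤ ·)).card := by
          refine Finset.card_le_card fun t ht => ?_
          rw [Finset.mem_filter] at ht ⊢
          exact ⟨ht.1, by omega⟩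
        rw [pow_succ', mul_assoc]
        refine step r _ har (by omega) hr (by positivity) ?_ x hx
        exact ih (s - (n + 1)) (by omega) j (r + n + 1) (by omega) (by omega) (by omega)

variable {W : Lattice d → ℝ} {E : ℝ}

/-- Two applications of the resolvent inequality: the concentric cube of radius `r - 1` leads from
the interior to the sphere of radius `r` at the cost `Q`, and the cube of radius `n` around a point
of that sphere gains `q`. On the sphere itself only the second is used, and `1 ≤ Q` absorbs the
difference. -/
theorem boundarySum_le_of_good_radius {u : Lattice d} {n N r : ℕ} {η q Q M : ℝ}
    (hη : 0 < η) (hNR : ∀ r, n ≤ r → r ≤ N → η ≤ Metric.infDist E (spec W (cube u r)))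
    (hgood : ∀ z, rad u z = r → E ∉ spec W (cube z n) ∧ boundarySum W z n E z ≤ q)
    (hq : 0 ≤ q) (hnr : n + 1 ≤ r) (hrN : r + n + 1 ≤ N) (hQ1 : 1 ≤ Q)
    (hQ : (2 * N + 3 : ℝ) ^ (2 * d) / η ≤ Q) (hM : 0 ≤ M)
    (hf : ∀ x ∈ cube u (r + n + 1), boundarySum W u N E x ≤ M) :
    ∀ x ∈ cube u r, boundarySum W u N E x ≤ Q * q * M := by
  have hΛ : E ∉ spec W (cube u N) := notMem_of_le_infDist hη (hNR N (by omega) le_rfl)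
  have hsphere : ∀ z, rad u z = r → boundarySum W u N E z ≤ q * M := by
    intro z hz
    obtain ⟨h1, h2⟩ := hgood z hz
    refine (boundarySum_le_mul (M := M) (by omega) hΛ h1 (self_mem_cube z n) ?_).trans
      (mul_le_mul_of_nonneg_right h2 hM)
    intro y hy
    refine hf y ?_
    rw [mem_cube_iff_rad]
    have := rad_triangle u z y
    omega
  intro x hx
  rw [mem_cube_iff_rad] at hx
  have hqM : 0 ≤ q * M := mul_nonneg hq hM
  rw [mul_assoc]
  rcases hx.eq_or_lt with h | h
  · refine (hsphere x h).trans ?_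
    exact le_mul_of_one_le_left hqM hQ1
  · have hNR' := hNR (r - 1) (by omega) (by omega)
    refine (boundarySum_le_mul (w := u) (r := r - 1) (M := q * M) ?_ hΛ
      (notMem_of_le_infDist hη hNR') ?_ ?_).trans (mul_le_mul_of_nonneg_right ?_ hqM)
    · rw [rad_self]
      omega
    · rw [mem_cube_iff_rad]
      omega
    · intro z hz
      exact hsphere z (by omega)
    · refine (boundarySum_le_card_div hη hNR' x).trans (le_trans ?_ hQ)
      have h3 : ((r - 1 : ℕ) : ℝ) ≤ N := by exact_mod_cast (by omega : r - 1 ≤ N)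
      gcongr

/-- Decay of the Green function in a completely non-resonant cube with few disjoint singular
subcubes. -/
theorem boundarySum_le_of_sparse {u : Lattice d} {n N c j : ℕ} {η q Q : ℝ}
    (hη : 0 < η) (hNR : ∀ r, n ≤ r → r ≤ N → η ≤ Metric.infDist E (spec W (cube u r)))
    (hS : ∀ F : Finset (Lattice d), (∀ w ∈ F, cube w n ⊆ cube u N) →
      (∀ w ∈ F, ∀ w' ∈ F, w ≠ w' → Disjoint (cube w n) (cube w' n)) →
      (∀ w ∈ F, ¬ (E ∉ spec W (cube w n) ∧ boundarySum W w n E w ≤ q)) → F.card ≤ c)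
    (hq : 0 ≤ q) (hQ1 : 1 ≤ Q) (hQ : (2 * N + 3 : ℝ) ^ (2 * d) / η ≤ Q)
    (hj : (n + 1) * j + c * (4 * n + 1) + (n + 1) ≤ N) :
    ∀ x ∈ cube u n, boundarySum W u N E x ≤ (Q * q) ^ j * Q := by
  classical
  set S := (cube u N).filter fun z =>
    rad u z + n ≤ N ∧ ¬ (E ∉ spec W (cube z n) ∧ boundarySum W z n E z ≤ q) with hSdef
  have hcard : (S.image (rad u)).card ≤ c * (4 * n + 1) := by
    refine card_image_rad_le S fun F hF hdisj => hS F ?_ hdisj ?_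
    · intro w hw
      exact cube_subset_cube (Finset.mem_filter.1 (hF hw)).2.1
    · intro w hw
      exact (Finset.mem_filter.1 (hF hw)).2.2
  intro x hx
  -- The descent ends at radius `n + 1`, since a jump uses the concentric cube of radius `r - 1`,
  -- known to be non-resonant only for `r - 1 ≥ n`.
  refine radial_descent (f := boundarySum W u N E) (a := n + 1) (N := N) (n := n) (u := u)
    (mul_nonneg (by linarith) hq) (by linarith) (S.image (rad u)) ?_ ?_ (N - (n + 1)) j (n + 1)
    (by omega) le_rfl ?_ x ?_
  · intro y _
    exact (boundarySum_le_card_div hη (hNR N (by omega) le_rfl) y).trans hQ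
  · intro r M' har hrN hr hM' hf
    refine boundarySum_le_of_good_radius hη hNR ?_ hq har hrN hQ1 hQ hM' hf
    intro z hz
    by_contra hcon
    refine hr (Finset.mem_image.2 ⟨z, Finset.mem_filter.2 ⟨?_, by omega, hcon⟩, hz⟩)
    rw [mem_cube_iff_rad]
    omega
  · have := Finset.card_filter_le (S.image (rad u)) (n + 1 ≤ ·)
    omega
  · rw [mem_cube_iff_rad] at hx ⊢
    omega

/-- Decay of the Green function in a cube all of whose sites are non-resonant. -/
theorem boundarySum_le_of_sites {u : Lattice d} {N : ℕ} {η Q : ℝ} (hη : 0 < η)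
    (hN : η ≤ Metric.infDist E (spec W (cube u N)))
    (h0 : ∀ z ∈ cube u N, η ≤ Metric.infDist E (spec W (cube z 0)))
    (hQ : (2 * N + 3 : ℝ) ^ (2 * d) / η ≤ Q) :
    boundarySum W u N E u ≤ Q ^ (N + 1) := by
  have hΛ := notMem_of_le_infDist hη hN
  have hQ0 : 0 ≤ Q := le_trans (by positivity) hQ
  rw [pow_succ]
  refine radial_descent (f := boundarySum W u N E) (a := 0) (N := N) (n := 0) (u := u)
    hQ0 hQ0 ∅ ?_ ?_ N N 0 (by omega) le_rfl (by simp) u (self_mem_cube u 0)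
  · intro y _
    exact (boundarySum_le_card_div hη hN y).trans hQ
  · intro r M' _ hrN _ hM' hf x hx
    rw [mem_cube_iff_rad] at hx
    have hNR := h0 x (mem_cube_iff_rad.2 (by omega))
    refine (boundarySum_le_mul (w := x) (r := 0) (M := M') (by omega) hΛ
      (notMem_of_le_infDist hη hNR) (self_mem_cube x 0) ?_).trans
        (mul_le_mul_of_nonneg_right ?_ hM')
    · intro z hz
      refine hf z ?_
      rw [mem_cube_iff_rad]
      have := rad_triangle u x z
      omega
    · refine (boundarySum_le_card_div hη hNR x).trans (le_trans ?_ hQ)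
      have h3 : ((0 : ℕ) : ℝ) ≤ N := Nat.cast_le.2 (Nat.zero_le N)
      gcongr

end Descent

/-! ### Lipschitz bound for `C¹` functions and the covering grid. -/

section Torus

variable {ν : ℕ}

theorem unitAddCircle_coe_int (n : ℤ) : ((n : ℝ) : UnitAddCircle) = 0 :=
  AddCircle.coe_eq_zero_iff 1 |>.2 ⟨n, by simp⟩

theorem exists_lift_dist (a b : UnitAddCircle) :
    ∃ s t : ℝ, (s : UnitAddCircle) = a ∧ (t : UnitAddCircle) = b ∧ |s - t| = dist a b := by
  obtain ⟨s, rfl⟩ := QuotientAddGroup.mk_surjective a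
  obtain ⟨t, rfl⟩ := QuotientAddGroup.mk_surjective b
  refine ⟨s - round (s - t), t, ?_, rfl, ?_⟩
  · rw [AddCircle.coe_sub, unitAddCircle_coe_int, sub_zero]
  · change _ = dist (s : UnitAddCircle) (t : UnitAddCircle)
    rw [dist_eq_norm, ← AddCircle.coe_sub, UnitAddCircle.norm_eq]
    congr 1
    ring

theorem dist_coe_le (s t : ℝ) : dist (s : UnitAddCircle) (t : UnitAddCircle) ≤ |s - t| := by
  rw [dist_eq_norm, ← AddCircle.coe_sub, UnitAddCircle.norm_eq]
  simpa using round_le (s - t) 0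

/-- Mean value inequality for the periodic lift, between lifts of the points that realize the circle
distance in each coordinate. In the max-norm the derivative is bounded by the sum of the `ν` partial
derivatives. -/
theorem C1Bound.abs_sub_le {f : Torus ν → ℝ} {K : ℝ} (hf : C1Bound f K) (ω ω' : Torus ν) :
    |f ω - f ω'| ≤ ν * K * dist ω ω' := by
  obtain ⟨hsm, hb, hd⟩ := hf
  have hK : 0 ≤ K := (abs_nonneg _).trans (hb ω)
  choose s t hs ht hst using fun i => exists_lift_dist (ω i) (ω' i)
  set F : (Fin ν → ℝ) → ℝ := fun t => f fun i => (t i : UnitAddCircle) with hF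
  have hfd : ∀ x, ‖fderiv ℝ F x‖ ≤ ν * K := by
    intro x
    refine ContinuousLinearMap.opNorm_le_bound _ (by positivity) fun y => ?_
    have h1 : fderiv ℝ F x y = ∑ i, y i * fderiv ℝ F x (Pi.single i 1) := by
      conv_lhs => rw [pi_eq_sum_univ' y, map_sum]
      refine Finset.sum_congr rfl fun i _ => ?_
      rw [map_smul, smul_eq_mul]
    rw [h1]
    calc ‖∑ i, y i * fderiv ℝ F x (Pi.single i 1)‖
        ≤ ∑ i, ‖y i * fderiv ℝ F x (Pi.single i 1)‖ := norm_sum_le _ _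
      _ ≤ ∑ _i : Fin ν, ‖y‖ * K := by
          refine Finset.sum_le_sum fun i _ => ?_
          rw [norm_mul]
          exact mul_le_mul (norm_le_pi_norm y i) (hd x i) (norm_nonneg _) (norm_nonneg _)
      _ = ν * K * ‖y‖ := by
          rw [Finset.sum_const, Finset.card_univ, Fintype.card_fin, nsmul_eq_mul]
          ring
  have h2 := Convex.norm_image_sub_le_of_norm_fderiv_le (𝕜 := ℝ) (f := F) (s := Set.univ) (x := t)
    (y := s) (fun x _ => hsm.differentiable one_ne_zero x) (fun x _ => hfd x)
    convex_univ (Set.mem_univ _) (Set.mem_univ _)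
  have h3 : F s = f ω := by
    simp only [hF, hs]
  have h4 : F t = f ω' := by
    simp only [hF, ht]
  rw [h3, h4] at h2
  refine h2.trans (mul_le_mul_of_nonneg_left ?_ (by positivity))
  rw [pi_norm_le_iff_of_nonneg dist_nonneg]
  intro i
  rw [Pi.sub_apply, Real.norm_eq_abs, hst i]
  exact dist_le_pi_dist ω ω' i

theorem exists_dist_gridCenter_le {N : ℕ} (hN : 0 < N) (ω : Torus ν) :
    ∃ l : Fin ν → Fin N, dist ω (gridCenter N l) ≤ 1 / (2 * (N : ℝ)) := by
  have hN' : (0 : ℝ) < N := Nat.cast_pos.2 hN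
  have h : ∀ i, ∃ l : Fin N, dist (ω i) (gridCenter N (fun _ : Fin ν => l) i) ≤
      1 / (2 * (N : ℝ)) := by
    intro i
    obtain ⟨t, ht⟩ := QuotientAddGroup.mk_surjective (ω i)
    have ht' : ((Int.fract t : ℝ) : UnitAddCircle) = ω i := by
      rw [← ht, Int.fract, AddCircle.coe_sub, unitAddCircle_coe_int, sub_zero]
    have h0 := Int.fract_nonneg t
    have h1 := Int.fract_lt_one t
    set s := Int.fract t
    have h2 : (⌊s * N⌋₊ : ℝ) ≤ s * N := Nat.floor_le (by positivity)
    have h3 : s * N < ⌊s * N⌋₊ + 1 := Nat.lt_floor_add_one _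
    have h4 : ⌊s * N⌋₊ < N := by
      rw [Nat.floor_lt (by positivity)]
      nlinarith
    refine ⟨⟨⌊s * N⌋₊, h4⟩, ?_⟩
    rw [← ht']
    refine (dist_coe_le _ _).trans ?_
    have h5 : s - ((2 * ⌊s * N⌋₊ + 1 : ℕ) : ℝ) * (1 / (2 * (N : ℝ))) =
        (2 * (s * N - ⌊s * N⌋₊) - 1) * (1 / (2 * (N : ℝ))) := by
      push_cast
      field_simp
      ring
    rw [h5, abs_mul, abs_of_pos (by positivity : 0 < 1 / (2 * (N : ℝ)))]
    refine mul_le_of_le_one_left (by positivity) ?_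
    rw [abs_le]
    constructor <;> linarith
  choose l hl using h
  exact ⟨l, (dist_pi_le_iff (by positivity)).2 hl⟩

end Torus

/-! ### At most `ν + 1` disjoint partially resonant cubes. -/

section Resonances

variable {d ν : ℕ} {Θ : Type*} {T : Lattice d → Torus ν → Torus ν} {v : Torus ν → Θ → ℝ}

theorem delta_pos {g : ℝ} (hg : 0 < g) (L₀ k : ℕ) : 0 < delta g L₀ k :=
  mul_pos (Real.rpow_pos_of_pos hg _) (Real.exp_pos _)

theorem gridNum_pos {g : ℝ} (hg : 0 < g) (L₀ k : ℕ) : 0 < gridNum ν g L₀ k := by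
  have := delta_pos hg L₀ k
  exact Nat.ceil_pos.2 (by positivity)

theorem one_div_gridNum_le {g : ℝ} (hg : 0 < g) (L₀ k : ℕ) :
    1 / (2 * (gridNum ν g L₀ k : ℝ)) ≤ delta g L₀ k ^ (1 + 1 / (2 * (ν : ℝ))) := by
  have h0 := delta_pos hg L₀ k
  have h1 := gridNum_pos (ν := ν) hg L₀ k
  have h2 : 1 / (2 * delta g L₀ k ^ (1 + 1 / (2 * (ν : ℝ)))) ≤ gridNum ν g L₀ k := Nat.le_ceil _
  have h3 : (0 : ℝ) < gridNum ν g L₀ k := Nat.cast_pos.2 h1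
  have h4 : 0 < delta g L₀ k ^ (1 + 1 / (2 * (ν : ℝ))) := Real.rpow_pos_of_pos h0 _
  rw [div_le_iff₀ (by positivity)] at h2 ⊢
  linarith

/-- The summand 1 covers `x = 0`, which `DIV` leaves out and where the map is the identity. -/
theorem dist_action_le (hT : IsDynSystem T) {A' C' : ℝ} (hA : 0 < A') (hC : 0 < C')
    (hDIV : DIV T A' C') {x : Lattice d} {X : ℝ} (hx : ‖x‖ ≤ X) (ω ω' : Torus ν) :
    dist (T x ω) (T x ω') ≤ (C' * X ^ A' + 1) * dist ω ω' := by
  have hX : 0 ≤ X := (norm_nonneg x).trans hx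
  have h0 : 0 ≤ C' * X ^ A' := by positivity
  by_cases h : x = 0
  · subst h
    rw [hT.1, hT.1]
    exact le_mul_of_one_le_left dist_nonneg (by linarith)
  · refine (hDIV ω ω' x h).trans (mul_le_mul_of_nonneg_right ?_ dist_nonneg)
    have : ‖x‖ ^ A' ≤ X ^ A' := Real.rpow_le_rpow (norm_nonneg _) hx hA.le
    nlinarith

/-- For `θ` in `nonResSet`, a cube of radius `L_k ^ 4` contains at most `ν + 1` pairwise disjoint
partially resonant cubes of radius `L_k`, for every phase point `ω`. -/
theorem card_le_of_isPR (hd : 1 ≤ d) (hT : IsDynSystem T) {A' C' K g : ℝ} (hA : 0 < A')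
    (hC : 0 < C') (hg : 0 < g) (hDIV : DIV T A' C') (hv : ∀ θ, C1Bound (fun ω => v ω θ) K)
    {L₀ k : ℕ}
    (hδ : ν * K * (C' * ((scale L₀ k : ℝ) ^ 4) ^ A' + 1) * delta g L₀ k ^ (1 / (2 * (ν : ℝ))) ≤ 1)
    {θ : Θ} (hθ : θ ∈ nonResSet T v g L₀ k) {ω : Torus ν} {E : ℝ} {u : Lattice d}
    {F : Finset (Lattice d)} (hsub : ∀ w ∈ F, cube w (scale L₀ k) ⊆ cube u (scale L₀ k ^ 4))
    (hdisj : ∀ w ∈ F, ∀ w' ∈ F, w ≠ w' → Disjoint (cube w (scale L₀ k)) (cube w' (scale L₀ k)))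
    (hPR : ∀ w ∈ F, IsPR (pot T v g ω θ) g L₀ k E w) : F.card ≤ ν + 1 := by
  by_contra! hcard
  have h0 := delta_pos hg L₀ k
  have hη : 0 < g * delta g L₀ k := mul_pos hg h0
  obtain ⟨e⟩ : Nonempty (Fin (ν + 2) ↪ F) := by
    refine Function.Embedding.nonempty_of_card_le ?_
    rw [Fintype.card_fin, Fintype.card_coe]
    exact hcard
  have hres : ∀ j, ∃ (ℓ : ℕ) (c : Lattice d) (a : ℝ), prevScale L₀ k ≤ ℓ ∧
      cube c ℓ ⊆ cube (e j).1 (scale L₀ k) ∧ a ∈ spec (pot T v g ω θ) (cube c ℓ) ∧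
      |E - a| < g * delta g L₀ k := by
    intro j
    have h1 := hPR _ (e j).2
    simp only [IsPR, IsCNR, IsNR] at h1
    push Not at h1
    obtain ⟨ℓ, c, hℓ, hc, h2⟩ := h1
    obtain ⟨a, ha, h3⟩ := (Metric.infDist_lt_iff (spec_nonempty _ c ℓ)).1 h2
    exact ⟨ℓ, c, a, hℓ, hc, ha, h3⟩
  choose ℓ c a hℓ hc ha hEa using hres
  obtain ⟨l, hl⟩ := exists_dist_gridCenter_le (gridNum_pos (ν := ν) hg L₀ k) (T u ω)
  set ω' := gridCenter (gridNum ν g L₀ k) l with hω'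
  have hKν : 0 ≤ ν * K := mul_nonneg (Nat.cast_nonneg _) ((abs_nonneg _).trans ((hv θ).2.1 ω))
  have hpert : ∀ x ∈ cube u (scale L₀ k ^ 4),
      |pot T v g ω θ x - pot T v g ω' θ (x - u)| ≤ g * delta g L₀ k := by
    intro x hx
    have hx' := (mem_cube u x _).1 hx
    push_cast at hx'
    have h1 : T x ω = T (x - u) (T u ω) := by rw [← hT.2.1, sub_add_cancel]
    simp only [pot]
    rw [← mul_sub, abs_mul, abs_of_pos hg, h1]
    refine mul_le_mul_of_nonneg_left ?_ hg.le
    calc |v (T (x - u) (T u ω)) θ - v (T (x - u) ω') θ|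
        ≤ ν * K * dist (T (x - u) (T u ω)) (T (x - u) ω') := (hv θ).abs_sub_le _ _
      _ ≤ ν * K * ((C' * ((scale L₀ k : ℝ) ^ 4) ^ A' + 1) *
            (delta g L₀ k ^ (1 + 1 / (2 * (ν : ℝ))))) := by
          refine mul_le_mul_of_nonneg_left ?_ hKν
          refine (dist_action_le hT hA hC hDIV hx' _ _).trans ?_
          exact mul_le_mul_of_nonneg_left (hl.trans (one_div_gridNum_le hg L₀ k)) (by positivity)
      _ = (ν * K * (C' * ((scale L₀ k : ℝ) ^ 4) ^ A' + 1) *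
            delta g L₀ k ^ (1 / (2 * (ν : ℝ)))) * delta g L₀ k := by
          rw [Real.rpow_add h0, Real.rpow_one]
          ring
      _ ≤ delta g L₀ k := mul_le_of_le_one_left h0.le hδ
  have hnear : ∀ j, ∃ a' ∈ spec (pot T v g ω' θ) (cube (c j - u) (ℓ j)),
      |a' - a j| ≤ g * delta g L₀ k := fun j =>
    exists_spec_near (fun x hx => hpert x (hsub _ (e j).2 (hc j hx))) (ha j)
  choose a' ha' haa' using hnear
  refine hθ (Set.mem_iUnion.2 ⟨l, ℓ, fun j => c j - u, fun j => (e j).1 - u, ?_, ?_, ?_, ?_, ?_⟩)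
  · exact fun j => ⟨hℓ j, le_of_cube_subset_cube hd (hc j)⟩
  · intro j x hx
    rw [mem_cube_sub_iff] at hx ⊢
    exact hc j hx
  · intro j x hx
    rw [mem_cube_sub_iff] at hx
    have h1 := hsub _ (e j).2 hx
    rw [← sub_mem_cube_sub_iff (u := u), sub_self, add_sub_cancel_right] at h1
    exact h1
  · intro i j hij
    have h1 : (e i).1 ≠ (e j).1 := fun h => hij (e.injective (Subtype.ext h))
    have h2 := (hdisj _ (e i).2 _ (e j).2 h1).mono (hc i) (hc j)
    rw [Finset.disjoint_left] at h2 ⊢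
    intro x hx hx'
    rw [mem_cube_sub_iff] at hx hx'
    exact h2 hx hx'
  · intro j _
    have h1 : setDist (spec (pot T v g ω' θ) (cube (c j - u) (ℓ j)))
        (spec (pot T v g ω' θ) (cube (c 0 - u) (ℓ 0))) ≤ |a' j - a' 0| := by
      refine csInf_le ⟨0, ?_⟩ (Set.mem_image2_of_mem (ha' j) (ha' 0))
      rintro _ ⟨p, _, q, _, rfl⟩
      exact abs_nonneg _
    -- Each of the two eigenvalues is within `g δ_k` of its unperturbed value, itself within `g δ_k`
    -- of `E`: this is the factor 4.
    refine h1.trans ?_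
    have h2 := abs_le.1 (haa' j)
    have h3 := abs_le.1 (haa' 0)
    have h4 := abs_lt.1 (hEa j)
    have h5 := abs_lt.1 (hEa 0)
    rw [abs_le]
    constructor <;> linarith

end Resonances

/-! ### Growth of the scales and arithmetic of the decay rates. -/

section Scales

open Filter Topology

theorem eventually_pow_le_exp_sqrt (d : ℕ) :
    ∀ᶠ N : ℕ in atTop, (2 * N + 3 : ℝ) ^ (2 * d) ≤ Real.exp ((N : ℝ) ^ (1 / 2 : ℝ)) := by
  have h1 := (Real.tendsto_pow_mul_exp_neg_atTop_nhds_zero (4 * d)).const_mul ((3 : ℝ) ^ (2 * d))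
  rw [mul_zero] at h1
  have h2 := h1.comp ((tendsto_rpow_atTop (by norm_num : (0 : ℝ) < 1 / 2)).comp
    (tendsto_natCast_atTop_atTop (R := ℝ)))
  filter_upwards [h2.eventually_le_const zero_lt_one, eventually_ge_atTop 3] with N hN hN3
  simp only [Function.comp_apply] at hN
  have h3 : (3 : ℝ) ≤ N := by exact_mod_cast hN3
  have h4 : ((N : ℝ) ^ (1 / 2 : ℝ)) ^ (4 * d) = (N : ℝ) ^ (2 * d) := by
    rw [← Real.rpow_natCast, ← Real.rpow_mul (by positivity), ← Real.rpow_natCast]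
    congr 1
    push_cast
    ring
  rw [h4, Real.exp_neg, ← mul_assoc, ← mul_pow, ← div_eq_mul_inv, div_le_one (Real.exp_pos _)] at hN
  refine le_trans ?_ hN
  gcongr
  linarith

/-- Power times exponential in the variable `√n`. The bound is uniform in `n`, so that one threshold
for `g` serves all scales. -/
theorem exists_rpow_mul_exp_le (A : ℝ) {ν : ℕ} (hν : 1 ≤ ν) :
    ∃ S : ℝ, ∀ n : ℕ, ((n : ℝ) ^ 4) ^ A *
      Real.exp (-4 * (n : ℝ) ^ (1 / 2 : ℝ)) ^ (1 / (2 * (ν : ℝ))) ≤ S := by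
  have hν' : (0 : ℝ) < ν := Nat.cast_pos.2 hν
  have h1 := (tendsto_rpow_mul_exp_neg_mul_atTop_nhds_zero (8 * A) (2 / ν) (by positivity)).comp
    ((tendsto_rpow_atTop (by norm_num : (0 : ℝ) < 1 / 2)).comp
      (tendsto_natCast_atTop_atTop (R := ℝ)))
  obtain ⟨S, hS⟩ := h1.bddAbove_range
  refine ⟨S, fun n => ?_⟩
  refine le_of_eq_of_le ?_ (hS (Set.mem_range_self n))
  simp only [Function.comp_apply]
  congr 1
  · rw [← Real.rpow_natCast, ← Real.rpow_mul (by positivity), ← Real.rpow_mul (by positivity)]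
    congr 1
    push_cast
    ring
  · rw [← Real.exp_mul]
    congr 1
    field_simp
    ring

theorem rpow_le_scale_succ (L₀ k : ℕ) :
    (scale L₀ k : ℝ) ^ (3 / 2 : ℝ) ≤ scale L₀ (k + 1) := by
  rw [scale]
  push_cast
  exact (Nat.lt_floor_add_one _).le

theorem scale_succ_le_rpow (L₀ k : ℕ) :
    (scale L₀ (k + 1) : ℝ) ≤ (scale L₀ k : ℝ) ^ (3 / 2 : ℝ) + 1 := by
  rw [scale]
  push_cast
  gcongr
  exact Nat.floor_le (by positivity)

theorem le_scale {L₀ : ℕ} (h : 1 ≤ L₀) (k : ℕ) : L₀ ≤ scale L₀ k := by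
  induction k with
  | zero => exact le_rfl
  | succ k ih =>
    refine ih.trans ?_
    have h1 : (1 : ℝ) ≤ scale L₀ k := by exact_mod_cast h.trans ih
    have h2 : (scale L₀ k : ℝ) ≤ (scale L₀ k : ℝ) ^ (3 / 2 : ℝ) := by
      conv_lhs => rw [← Real.rpow_one (scale L₀ k : ℝ)]
      exact Real.rpow_le_rpow_of_exponent_le h1 (by norm_num)
    exact_mod_cast h2.trans (rpow_le_scale_succ L₀ k)

theorem exists_mul_add_le_lt {p B N : ℕ} (hp : 0 < p) (hB : B ≤ N) :
    ∃ j : ℕ, p * j + B ≤ N ∧ N < p * j + p + B := by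
  have h1 := Nat.mul_div_le (N - B) p
  have h2 := Nat.lt_mul_div_succ (N - B) hp
  rw [mul_add, mul_one] at h2
  exact ⟨(N - B) / p, by omega, by omega⟩

/-- The arithmetic of the induction step: `j` jumps of length `n + 1` can be made inside the
radius `N ≈ n ^ (3 / 2)`, and they produce the decay rate required at the scale `N`. -/
theorem exists_jumps {n N c : ℕ} {m t : ℝ} (hm : 1 ≤ m) (htn : t ^ 16 = n)
    (ht : 2 * (5 * c + 4) + 35 ≤ t) (hN1 : t ^ 24 ≤ N) (hN2 : (N : ℝ) ≤ t ^ 24 + 1) :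
    ∃ j : ℕ, (n + 1) * j + c * (4 * n + 1) + (n + 1) ≤ N ∧
      (Real.exp (5 * (N : ℝ) ^ (1 / 2 : ℝ)) * Real.exp (-(gammaRate m n * n))) ^ j *
        Real.exp (5 * (N : ℝ) ^ (1 / 2 : ℝ)) ≤ Real.exp (-(gammaRate m N * N)) := by
  -- With `t = n ^ (1 / 16)` all exponents are integers: `N ≈ t ^ 24`, `√N ≈ t ^ 12`, about `t ^ 8`
  -- jumps, and the rate corrections `n ^ (-1/8) = t ^ (-2)` and `N ^ (-1/8) ≤ t ^ (-3)`.
  have hc : (0 : ℝ) ≤ c := Nat.cast_nonneg c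
  have ht1 : 35 ≤ t := by linarith
  have ht0 : 0 < t := by linarith
  have hT1 : 1 ≤ t ^ 16 := one_le_pow₀ (by linarith)
  have ht8 : t ≤ t ^ 8 := le_self_pow₀ (by linarith) (by norm_num)
  have h24 : t ^ 24 = t ^ 16 * t ^ 8 := by ring
  have hDT : (5 * c + 4) * t ^ 16 ≤ t ^ 24 := by
    rw [h24, mul_comm]
    exact mul_le_mul_of_nonneg_left (by linarith) (by positivity)
  have hcT : c ≤ c * t ^ 16 := le_mul_of_one_le_right hc hT1
  have hroom : (n + 1) + c * (4 * n + 1) ≤ N := by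
    have h1 : ((n : ℝ) + 1) + c * (4 * n + 1) ≤ N := by
      rw [← htn]
      linarith
    exact_mod_cast h1
  obtain ⟨j, hj1, hj2⟩ := exists_mul_add_le_lt n.succ_pos hroom
  refine ⟨j, by rw [Nat.succ_eq_add_one] at hj1; linarith, ?_⟩
  have hj2' : (N : ℝ) < (t ^ 16 + 1) * j + (t ^ 16 + 1) + ((t ^ 16 + 1) + c * (4 * t ^ 16 + 1)) := by
    have h1 : (N : ℝ) < (n + 1) * j + (n + 1) + ((n + 1) + c * (4 * n + 1)) := by
      exact_mod_cast hj2
    rwa [htn]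
  have hj1' : (t ^ 16 + 1) * j + c * (4 * t ^ 16 + 1) + (t ^ 16 + 1) ≤ N := by
    have h1 : ((n : ℝ) + 1) * j + ((n + 1) + c * (4 * n + 1)) ≤ N := by
      exact_mod_cast hj1
    rw [htn]
    linarith
  have hj0 : (0 : ℝ) ≤ j := Nat.cast_nonneg j
  have hj3 : (j : ℝ) ≤ 2 * t ^ 8 := by
    have h1 : t ^ 16 * j ≤ t ^ 16 * (2 * t ^ 8) := by
      have h2 : 0 ≤ c * (4 * t ^ 16 + 1) := by positivity
      have h3 : 1 ≤ t ^ 24 := one_le_pow₀ (by linarith)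
      linarith
    exact le_of_mul_le_mul_left h1 (by positivity)
  have h8T : t ^ 8 ≤ t ^ 16 := pow_le_pow_right₀ (by linarith) (by norm_num)
  have hj4 : N - (5 * c + 6) * t ^ 16 ≤ j * t ^ 16 := by linarith
  set R := (N : ℝ) ^ (1 / 2 : ℝ) with hR
  have hN0 : (0 : ℝ) < N := lt_of_lt_of_le (by positivity) hN1
  have hR0 : 0 ≤ R := by positivity
  have hR2 : R ≤ 2 * t ^ 12 := by
    have h1 : R ^ 2 = N := by
      rw [hR, ← Real.rpow_natCast, ← Real.rpow_mul hN0.le]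
      norm_num
    have h3 : 1 ≤ t ^ 24 := one_le_pow₀ (by linarith)
    refine le_of_sq_le_sq ?_ (by positivity)
    rw [h1]
    linarith
  have hjR : j * R ≤ 4 * t ^ 20 := by
    calc j * R ≤ (2 * t ^ 8) * (2 * t ^ 12) := mul_le_mul hj3 hR2 hR0 (by positivity)
      _ = 4 * t ^ 20 := by ring
  have h12 : t ^ 12 ≤ t ^ 20 := pow_le_pow_right₀ (by linarith) (by norm_num)
  have h16 : t ^ 16 ≤ t ^ 20 := pow_le_pow_right₀ (by linarith) (by norm_num)
  have ha : (n : ℝ) ^ (-(1 / 8) : ℝ) = (t ^ 2)⁻¹ := by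
    rw [← htn, ← Real.rpow_natCast, ← Real.rpow_natCast, ← Real.rpow_mul ht0.le,
      ← Real.rpow_neg ht0.le]
    norm_num
  have hb : (N : ℝ) ^ (-(1 / 8) : ℝ) ≤ (t ^ 3)⁻¹ := by
    have h1 : (t ^ 24) ^ (-(1 / 8) : ℝ) = (t ^ 3)⁻¹ := by
      rw [← Real.rpow_natCast, ← Real.rpow_natCast, ← Real.rpow_mul ht0.le,
        ← Real.rpow_neg ht0.le]
      norm_num
    rw [← h1]
    exact Real.rpow_le_rpow_of_nonpos (by positivity) hN1 (by norm_num)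
  rw [← Real.exp_add, ← Real.exp_nat_mul, ← Real.exp_add, Real.exp_le_exp, gammaRate, gammaRate,
    ha, ← htn]
  have ha1 : (t ^ 2)⁻¹ ≤ 1 := inv_le_one_of_one_le₀ (one_le_pow₀ (by linarith))
  -- The main term: the lower rate required at scale `N` frees order `t ^ 22`, which beats the
  -- losses of order `t ^ 20` from lost radii and resonances.
  have hab : t ^ 22 - t ^ 21 ≤ ((t ^ 2)⁻¹ - (t ^ 3)⁻¹) * N := by
    have h1 : t ^ 22 - t ^ 21 = ((t ^ 2)⁻¹ - (t ^ 3)⁻¹) * t ^ 24 := by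
      field_simp
    rw [h1]
    refine mul_le_mul_of_nonneg_left hN1 (sub_nonneg.2 ?_)
    exact inv_anti₀ (by positivity) (pow_le_pow_right₀ (by linarith) (by norm_num))
  have hbN : (N : ℝ) ^ (-(1 / 8) : ℝ) * N ≤ (t ^ 3)⁻¹ * N := mul_le_mul_of_nonneg_right hb hN0.le
  have hjT : (1 + (t ^ 2)⁻¹) * (N - (5 * c + 6) * t ^ 16) ≤ (1 + (t ^ 2)⁻¹) * (j * t ^ 16) :=
    mul_le_mul_of_nonneg_left hj4 (by positivity)
  have hsmall : (1 + (t ^ 2)⁻¹) * ((5 * c + 6) * t ^ 16) ≤ 2 * ((5 * c + 6) * t ^ 20) :=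
    mul_le_mul (by linarith) (mul_le_mul_of_nonneg_left h16 (by positivity)) (by positivity)
      (by norm_num)
  have hquad : 30 * t ^ 20 ≤ t ^ 22 - t ^ 21 - 2 * ((5 * c + 6) * t ^ 20) := by
    have h1 : t ^ 22 - t ^ 21 - 2 * ((5 * c + 6) * t ^ 20) =
        (t * (t - 1) - 2 * (5 * c + 6)) * t ^ 20 := by ring
    rw [h1]
    refine mul_le_mul_of_nonneg_right ?_ (by positivity)
    have h2 : 35 * t ≤ t * t := mul_le_mul_of_nonneg_right ht1 ht0.le
    linarith
  -- The factors `exp (5 R)` cost `5 (j + 1) R ≤ 20 t ^ 20 + 10 t ^ 12 ≤ 30 t ^ 20`. This cost does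
  -- not scale with `m`, hence the assumption `1 ≤ m`.
  have hgain : 30 * t ^ 20 ≤
      (1 + (t ^ 2)⁻¹) * (j * t ^ 16) - (1 + (N : ℝ) ^ (-(1 / 8) : ℝ)) * N := by
    linarith
  have hgain' : 30 * t ^ 20 ≤
      m * ((1 + (t ^ 2)⁻¹) * (j * t ^ 16) - (1 + (N : ℝ) ^ (-(1 / 8) : ℝ)) * N) :=
    hgain.trans (le_mul_of_one_le_left (le_trans (by positivity) hgain) hm)
  linarith

end Scales

/-! ### Singular cubes are partially resonant; induction on the scale. -/

section Induction

variable {d ν : ℕ}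

theorem mul_delta_eq {g : ℝ} (hg : 0 < g) (L₀ k : ℕ) :
    g * delta g L₀ k =
      Real.exp (Real.log g / 2 - 4 * (scale L₀ k : ℝ) ^ (1 / 2 : ℝ)) := by
  rw [delta, Real.rpow_def_of_pos hg]
  nth_rewrite 1 [← Real.exp_log hg]
  rw [← Real.exp_add, ← Real.exp_add]
  congr 1
  ring

theorem IsNS.mono {W : Lattice d → ℝ} {L₀ k : ℕ} {E m m' : ℝ} {u : Lattice d} (h : m' ≤ m)
    (hNS : IsNS W L₀ k E m u) : IsNS W L₀ k E m' u := by
  refine ⟨hNS.1, fun x hx => (hNS.2 x hx).trans ?_⟩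
  rw [Real.exp_le_exp, neg_le_neg_iff, gammaRate, gammaRate]
  gcongr

/-- As `L_{-1} = 0`, single sites are non-resonant and each unit step gains `g ^ (-1/4)`. Since
`γ(m, L₀) ≤ 2 m`, this permits `m = (log g) / 8`, whence `c₁ = 1 / 8`. -/
theorem isNS_zero {W : Lattice d → ℝ} {g : ℝ} {L₀ : ℕ} {E : ℝ} {u : Lattice d} (hL : 1 ≤ L₀)
    (hg1 : 1 ≤ g)
    (hg : Real.exp (4 * (Real.log ((2 * L₀ + 3 : ℝ) ^ (2 * d)) + 4 * (L₀ : ℝ) ^ (1 / 2 : ℝ))) ≤ g)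
    (h : IsCNR W g L₀ 0 E u) : IsNS W L₀ 0 E (1 / 8 * Real.log g) u := by
  have hg0 : 0 < g := by linarith
  have hη : 0 < g * delta g L₀ 0 := mul_pos hg0 (delta_pos hg0 _ _)
  have hN : g * delta g L₀ 0 ≤ Metric.infDist E (spec W (cube u L₀)) :=
    h L₀ u (Nat.zero_le _) (Finset.Subset.refl _)
  refine ⟨notMem_of_le_infDist hη hN, fun x hx => ?_⟩
  have hxu : x = u := by
    rw [prevScale, Nat.cast_zero, norm_le_zero_iff, sub_eq_zero] at hx
    exact hx
  subst hxu
  have h0 : ∀ z ∈ cube x L₀, g * delta g L₀ 0 ≤ Metric.infDist E (spec W (cube z 0)) := by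
    intro z hz
    refine h 0 z (Nat.zero_le _) (cube_subset_cube ?_)
    exact mem_cube_iff_rad.1 hz
  have hlog := Real.log_nonneg hg1
  rw [← Real.le_log_iff_exp_le hg0] at hg
  have hQ : (2 * L₀ + 3 : ℝ) ^ (2 * d) / (g * delta g L₀ 0) ≤ Real.exp (-(Real.log g / 4)) := by
    rw [mul_delta_eq hg0, ← Real.exp_log (by positivity : (0 : ℝ) < (2 * L₀ + 3 : ℝ) ^ (2 * d)),
      ← Real.exp_sub, Real.exp_le_exp]
    have : (scale L₀ 0 : ℝ) = L₀ := rfl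
    rw [this]
    linarith
  refine (boundarySum_le_of_sites hη hN h0 hQ).trans ?_
  rw [← Real.exp_nat_mul, Real.exp_le_exp, gammaRate]
  have hL' : (1 : ℝ) ≤ L₀ := by exact_mod_cast hL
  have h1 : (L₀ : ℝ) ^ (-(1 / 8) : ℝ) ≤ 1 := Real.rpow_le_one_of_one_le_of_nonpos hL' (by norm_num)
  have h2 : 1 / 8 * Real.log g * (1 + (L₀ : ℝ) ^ (-(1 / 8) : ℝ)) * L₀ ≤
      1 / 8 * Real.log g * 2 * L₀ := by
    gcongr
    linarith
  have : (scale L₀ 0 : ℝ) = L₀ := rfl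
  rw [this]
  push_cast
  nlinarith

theorem isNS_succ {W : Lattice d → ℝ} {g m : ℝ} {L₀ k c : ℕ} {E : ℝ} {u : Lattice d}
    (hL1 : 1 ≤ L₀) (hLc : (2 * (5 * c + 4) + 35) ^ 16 ≤ L₀)
    (hLd : ∀ N : ℕ, L₀ ≤ N → (2 * N + 3 : ℝ) ^ (2 * d) ≤ Real.exp ((N : ℝ) ^ (1 / 2 : ℝ)))
    (hg1 : 1 ≤ g) (hm : 1 ≤ m)
    (hsparse : ∀ F : Finset (Lattice d),
      (∀ w ∈ F, cube w (scale L₀ k) ⊆ cube u (scale L₀ k ^ 4)) →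
      (∀ w ∈ F, ∀ w' ∈ F, w ≠ w' → Disjoint (cube w (scale L₀ k)) (cube w' (scale L₀ k))) →
      (∀ w ∈ F, IsSingular W L₀ k E m w) → F.card ≤ c)
    (h : IsCNR W g L₀ (k + 1) E u) : IsNS W L₀ (k + 1) E m u := by
  have hg0 : 0 < g := by linarith
  have hη : 0 < g * delta g L₀ (k + 1) := mul_pos hg0 (delta_pos hg0 _ _)
  have hNR : ∀ r, scale L₀ k ≤ r → r ≤ scale L₀ (k + 1) →
      g * delta g L₀ (k + 1) ≤ Metric.infDist E (spec W (cube u r)) := by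
    intro r h1 h2
    refine h r u h1 (cube_subset_cube ?_)
    rwa [rad_self, zero_add]
  set n := scale L₀ k with hn
  set N := scale L₀ (k + 1) with hNdef
  have hn1 : L₀ ≤ n := le_scale hL1 k
  have hN1 : L₀ ≤ N := le_scale hL1 (k + 1)
  set t := (n : ℝ) ^ (1 / 16 : ℝ) with ht
  have hn0 : (0 : ℝ) ≤ n := Nat.cast_nonneg n
  have htn : t ^ 16 = n := by
    rw [ht, ← Real.rpow_natCast, ← Real.rpow_mul hn0]
    norm_num
  have ht24 : t ^ 24 = (n : ℝ) ^ (3 / 2 : ℝ) := by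
    rw [ht, ← Real.rpow_natCast, ← Real.rpow_mul hn0]
    norm_num
  have htc : 2 * (5 * c + 4) + 35 ≤ t := by
    refine le_of_pow_le_pow_left₀ (n := 16) (by norm_num) (by positivity) ?_
    rw [htn]
    exact_mod_cast hLc.trans hn1
  have hc0 : (0 : ℝ) ≤ c := Nat.cast_nonneg c
  have hNt1 : t ^ 24 ≤ N := ht24 ▸ rpow_le_scale_succ L₀ k
  have hNt2 : (N : ℝ) ≤ t ^ 24 + 1 := ht24 ▸ scale_succ_le_rpow L₀ k
  -- So the whole cube of radius `N` lies in the region where sparseness at the previous scale is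
  -- known.
  have hNn : N ≤ n ^ 4 := by
    have h1 : (N : ℝ) ≤ (n : ℝ) ^ 4 := by
      rw [← htn]
      have h2 : 1 ≤ t ^ 24 := one_le_pow₀ (by linarith)
      have h3 : t ≤ t ^ 40 := le_self_pow₀ (by linarith) (by norm_num)
      calc (N : ℝ) ≤ t ^ 24 + 1 := hNt2
        _ ≤ t ^ 24 * t ^ 40 := by nlinarith
        _ = (t ^ 16) ^ 4 := by ring
    exact_mod_cast h1
  obtain ⟨j, hj, hdecay⟩ := exists_jumps hm htn htc hNt1 hNt2
  have hR0 : 0 ≤ (N : ℝ) ^ (1 / 2 : ℝ) := by positivity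
  refine ⟨notMem_of_le_infDist hη (hNR N (by omega) le_rfl), fun x hx => ?_⟩
  refine (boundarySum_le_of_sparse hη hNR (c := c) (j := j)
    (q := Real.exp (-(gammaRate m n * n))) (Q := Real.exp (5 * (N : ℝ) ^ (1 / 2 : ℝ)))
    ?_ (Real.exp_pos _).le (Real.one_le_exp (by positivity)) ?_ hj x
    ((mem_cube u x _).2 hx)).trans hdecay
  · intro F hF hdisj hsing
    refine hsparse F (fun w hw => (hF w hw).trans (cube_subset_cube ?_)) hdisj fun w hw hNS => ?_
    · rw [rad_self, zero_add]
      exact hNn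
    · refine hsing w hw ⟨hNS.1, hNS.2 w ?_⟩
      rw [sub_self, norm_zero]
      exact Nat.cast_nonneg _
  · rw [mul_delta_eq hg0, div_le_iff₀ (Real.exp_pos _), ← Real.exp_add]
    refine (hLd N hN1).trans (Real.exp_le_exp.2 ?_)
    have := Real.log_nonneg hg1
    linarith

/-- The power of `δ_k` splits off `g ^ (-1 / (4ν))`, which absorbs all constants; its exponential
part beats the polynomial growth in `L_k`. -/
theorem mul_delta_rpow_le_one {A' C' K S g : ℝ} (hν : 1 ≤ ν) (hC : 0 < C') (hK : 0 < K)
    (hS : ∀ n : ℕ, ((n : ℝ) ^ 4) ^ A' *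
      Real.exp (-4 * (n : ℝ) ^ (1 / 2 : ℝ)) ^ (1 / (2 * (ν : ℝ))) ≤ S) (hg : 0 < g)
    (hgS : (ν * K * (C' * S + 1)) ^ (4 * ν) ≤ g) (L₀ k : ℕ) :
    ν * K * (C' * ((scale L₀ k : ℝ) ^ 4) ^ A' + 1) * delta g L₀ k ^ (1 / (2 * (ν : ℝ))) ≤ 1 := by
  have hν' : (0 : ℝ) < ν := Nat.cast_pos.2 hν
  have h1 := hS (scale L₀ k)
  set X := ((scale L₀ k : ℝ) ^ 4) ^ A' with hX
  set e := Real.exp (-4 * (scale L₀ k : ℝ) ^ (1 / 2 : ℝ)) ^ (1 / (2 * (ν : ℝ))) with he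
  have hX0 : 0 ≤ X := by positivity
  have he0 : 0 ≤ e := by positivity
  have he1 : e ≤ 1 := by
    refine Real.rpow_le_one (Real.exp_pos _).le (Real.exp_le_one_iff.2 ?_) (by positivity)
    have : 0 ≤ (scale L₀ k : ℝ) ^ (1 / 2 : ℝ) := by positivity
    linarith
  have hS0 : 0 ≤ S := le_trans (by positivity) h1
  have hδ : delta g L₀ k ^ (1 / (2 * (ν : ℝ))) = (g ^ (1 / (4 * (ν : ℝ))))⁻¹ * e := by
    rw [delta, Real.mul_rpow (by positivity) (Real.exp_pos _).le, ← Real.rpow_mul hg.le,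
      ← Real.rpow_neg hg.le]
    congr 2
    field_simp
    norm_num
  set G := g ^ (1 / (4 * (ν : ℝ))) with hG
  have hG0 : 0 < G := Real.rpow_pos_of_pos hg _
  have hB : ν * K * (C' * S + 1) ≤ G := by
    refine le_of_pow_le_pow_left₀ (n := 4 * ν) (by omega) hG0.le (hgS.trans (le_of_eq ?_))
    rw [hG, ← Real.rpow_natCast, ← Real.rpow_mul hg.le]
    push_cast
    rw [one_div_mul_cancel (by positivity), Real.rpow_one]
  rw [hδ]
  have h2 : ν * K * (C' * X + 1) * (G⁻¹ * e) = ν * K * (C' * (X * e) + e) * G⁻¹ := by ring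
  rw [h2, mul_inv_le_iff₀ hG0, one_mul]
  refine le_trans ?_ hB
  gcongr

variable {Θ : Type*} {T : Lattice d → Torus ν → Torus ν} {v : Torus ν → Θ → ℝ}

theorem sparseOn_of_large {A' C' K g : ℝ} {L₀ : ℕ} (hd : 1 ≤ d) (hL1 : 1 ≤ L₀)
    (hLc : (2 * (5 * (ν + 1) + 4) + 35) ^ 16 ≤ L₀)
    (hLd : ∀ N : ℕ, L₀ ≤ N → (2 * N + 3 : ℝ) ^ (2 * d) ≤ Real.exp ((N : ℝ) ^ (1 / 2 : ℝ)))
    (hA : 0 < A') (hC : 0 < C') (hg8 : Real.exp 8 ≤ g)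
    (hg : Real.exp (4 * (Real.log ((2 * L₀ + 3 : ℝ) ^ (2 * d)) + 4 * (L₀ : ℝ) ^ (1 / 2 : ℝ))) ≤ g)
    (hδ : ∀ k, ν * K * (C' * ((scale L₀ k : ℝ) ^ 4) ^ A' + 1) *
      delta g L₀ k ^ (1 / (2 * (ν : ℝ))) ≤ 1)
    (hT : IsDynSystem T) (hDIV : DIV T A' C') (hv : ∀ θ, C1Bound (fun ω => v ω θ) K) (k : ℕ) :
    SparseOn T v g (1 / 8 * Real.log g) L₀ k (⋂ l ∈ Set.Iic k, nonResSet T v g L₀ l) := by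
  have hg1 : 1 ≤ g := (Real.one_le_exp (by norm_num)).trans hg8
  have hg0 : 0 < g := by linarith
  have hm : 1 ≤ 1 / 8 * Real.log g := by
    rw [← Real.le_log_iff_exp_le hg0] at hg8
    linarith
  induction k with
  | zero =>
    intro θ hθ ω E u F hsub hdisj hsing
    refine card_le_of_isPR (ω := ω) (E := E) hd hT hA hC hg0 hDIV hv (hδ 0)
      (Set.mem_iInter₂.1 hθ 0 (Set.mem_Iic.2 le_rfl)) hsub hdisj fun w hw hCNR => ?_
    exact hsing w hw (isNS_zero hL1 hg1 hg hCNR)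
  | succ k ih =>
    intro θ hθ ω E u F hsub hdisj hsing
    refine card_le_of_isPR (ω := ω) (E := E) hd hT hA hC hg0 hDIV hv (hδ (k + 1))
      (Set.mem_iInter₂.1 hθ (k + 1) (Set.mem_Iic.2 le_rfl)) hsub hdisj fun w hw hCNR => ?_
    refine hsing w hw (isNS_succ (c := ν + 1) hL1 hLc hLd hg1 hm ?_ hCNR)
    refine ih θ (Set.mem_iInter₂.2 fun l hl => ?_) ω E w
    exact Set.mem_iInter₂.1 hθ l (Set.mem_Iic.2 ((Set.mem_Iic.1 hl).trans (Nat.le_succ k)))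

/-- Singularity at a smaller rate implies it at a larger one. So the induction is run only at the
largest rate, which is at least 1, and arbitrarily small `m` follow. -/
theorem SparseOn.anti {g m m' : ℝ} {L₀ k : ℕ} {S S' : Set Θ} (hS : S' ⊆ S) (hm : m' ≤ m)
    (h : SparseOn T v g m L₀ k S) : SparseOn T v g m' L₀ k S' :=
  fun θ hθ ω E u F hsub hdisj hsing =>
    h θ (hS hθ) ω E u F hsub hdisj fun w hw hNS => hsing w hw (hNS.mono hm)

end Induction

end GrandEnsemble

end

theorem mainTheorem4 (d ν : ℕ) (hd : 1 ≤ d) (hν : 1 ≤ ν) :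
    ∃ (c₁ : ℝ) (Lstar : ℕ), 0 < c₁ ∧
      ∀ L₀ : ℕ, Lstar ≤ L₀ → ∀ A' C' K : ℝ, 0 < A' → 0 < C' → 0 < K →
        ∃ g₀ : ℝ, 0 < g₀ ∧ ∀ g m : ℝ, g₀ ≤ g → 0 < m → m ≤ c₁ * Real.log g →
          ∀ (Θ : Type*) (T : GrandEnsemble.Lattice d → GrandEnsemble.Torus ν → GrandEnsemble.Torus ν)
            (v : GrandEnsemble.Torus ν → Θ → ℝ),
            GrandEnsemble.IsDynSystem T →
            GrandEnsemble.DIV T A' C' →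
            (∀ θ : Θ, GrandEnsemble.C1Bound (fun ω => v ω θ) K) →
            ∀ k : ℕ,
              GrandEnsemble.Sparse T v g m L₀ k ∧
              GrandEnsemble.SparseOn T v g m L₀ k
                (⋂ l ∈ Set.Iic k, GrandEnsemble.nonResSet T v g L₀ l) := by
  obtain ⟨N₀, hN₀⟩ := Filter.eventually_atTop.1 (GrandEnsemble.eventually_pow_le_exp_sqrt d)
  refine ⟨1 / 8, max N₀ ((2 * (5 * (ν + 1) + 4) + 35) ^ 16), by norm_num, ?_⟩
  intro L₀ hL A' C' K hA hC hK
  have hLc := (le_max_right _ _).trans hL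
  have hL1 : 1 ≤ L₀ := le_trans (Nat.one_le_pow _ _ (by omega)) hLc
  obtain ⟨S, hS⟩ := GrandEnsemble.exists_rpow_mul_exp_le A' hν
  -- The three thresholds serve `1 ≤ (log g) / 8`, the initial scale, and the passage to the grid at
  -- all scales.
  refine ⟨max (Real.exp 8) (max
    (Real.exp (4 * (Real.log ((2 * L₀ + 3 : ℝ) ^ (2 * d)) + 4 * (L₀ : ℝ) ^ (1 / 2 : ℝ))))
    ((ν * K * (C' * S + 1)) ^ (4 * ν))), lt_max_of_lt_left (Real.exp_pos _), ?_⟩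
  intro g m hg _ hm Θ T v hT hDIV hv k
  obtain ⟨hg8, hg⟩ := max_le_iff.1 hg
  obtain ⟨hgL, hgS⟩ := max_le_iff.1 hg
  have hg0 : 0 < g := (Real.exp_pos 8).trans_le hg8
  have main := GrandEnsemble.sparseOn_of_large hd hL1 hLc
    (fun N hN => hN₀ N (((le_max_left _ _).trans hL).trans hN)) hA hC hg8 hgL
    (GrandEnsemble.mul_delta_rpow_le_one hν hC hK hS hg0 hgS L₀) hT hDIV hv k
  exact ⟨main.anti (Set.iInter₂_mono fun l _ => Set.sdiff_subset) hm,
    main.anti (Set.Subset.refl _) hm⟩
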